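/- Let $R>0$, $T>0$, and let $f,g:(0,\infty)\to\mathbb{R}$ be $C^1$ and nondecreasing. Functions on the torus $R\mathbb{T}$ of length $R$ are identified with $R$-periodic functions on $\mathbb{R}$. Let $u\in C^2(R\mathbb{T}\times[0,T])$ and $m\in C^1(R\mathbb{T}\times[0,T])$, with $m>0$ on $R\mathbb{T}\times[0,T]$, be a classical solution of the system $$-u_t+\tfrac12 u_x^2=f(m),\qquad m_t-(m u_x)_x=0\qquad\text{in } R\mathbb{T}\times(0,T),$$ complemented either with the terminal-cost conditions (a) $m(x,0)=m_0(x)$, $u(x,T)=g(m(x,T))$ for all $x$, or with the planning conditions (b) $m(x,0)=m_0(x)$, $m(x,T)=m_T(x)$ for all $x$. Assume that $m_0$ (and also $m_T$ in case (b)) is even, nonincreasing on $[0,R/2]$ and nondecreasing on $[-R/2,0]$. For $x\in\mathbb{R}$, the optimal trajectory $\gamma(x,\cdot)$ starting from $x$ is the solution of $\gamma_t(x,t)=-u_x(\gamma(x,t),t)$ for $t\in[0,T]$, $\gamma(x,0)=x$. Then: 1. for every $t\in[0,T]$, $m(\cdot,t)$ is even, nonincreasing on $[0,R/2]$ and nondecreasing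 on $[-R/2,0]$; 2. for every $x\in[0,R/2]$, the optimal trajectory $\gamma(x,\cdot)$ is concave on $[0,T]$; 3. in case (a), for every $x\in[0,R/2]$, $\gamma(x,\cdot)$ is moreover nondecreasing on $[0,T]$, and $u_x(x,t)\le 0$ for all $(x,t)\in[0,R/2]\times[0,T]$. -/

import Mathlib

open Set

/-- A classical solution `(u, m)`, with `m > 0`, of the mean field game system
`-u_t + u_x² / 2 = f(m)`, `m_t - (m u_x)_x = 0` on the torus of length `R` and the time interval
`(0, T)`. Functions on the torus are `R`-periodic functions on `ℝ`; `u` is `C²` and `m` is `C¹` up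
to the times `0` and `T`. The first argument of `u` and `m` is space, the second one time. -/
structure IsPositiveClassicalSolution (R T : ℝ) (f : ℝ → ℝ) (u m : ℝ → ℝ → ℝ) : Prop where
  periodic_u : ∀ t ∈ Icc 0 T, Function.Periodic (fun x => u x t) R
  periodic_m : ∀ t ∈ Icc 0 T, Function.Periodic (fun x => m x t) R
  contDiffOn_u : ContDiffOn ℝ 2 (fun p : ℝ × ℝ => u p.1 p.2) (univ ×ˢ Icc 0 T)
  contDiffOn_m : ContDiffOn ℝ 1 (fun p : ℝ × ℝ => m p.1 p.2) (univ ×ˢ Icc 0 T)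
  pos : ∀ x, ∀ t ∈ Icc 0 T, 0 < m x t
  hamiltonJacobi : ∀ x, ∀ t ∈ Ioo 0 T,
    -deriv (fun s => u x s) t + 1 / 2 * (deriv (fun y => u y t) x) ^ 2 = f (m x t)
  continuity : ∀ x, ∀ t ∈ Ioo 0 T,
    deriv (fun s => m x s) t - deriv (fun y => m y t * deriv (fun z => u z t) y) x = 0

/-- `(u, m)` solves the mean field game problem with initial density `m₀` and terminal cost
`u(x, T) = g(m(x, T))`. -/
structure SolvesTerminalCost (R T : ℝ) (f g m₀ : ℝ → ℝ) (u m : ℝ → ℝ → ℝ) : Prop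
    extends IsPositiveClassicalSolution R T f u m where
  initial : ∀ x, m x 0 = m₀ x
  terminal : ∀ x, u x T = g (m x T)

/-- `(u, m)` solves the planning problem with initial density `m₀` and terminal density `mT`. -/
structure SolvesPlanning (R T : ℝ) (f m₀ mT : ℝ → ℝ) (u m : ℝ → ℝ → ℝ) : Prop
    extends IsPositiveClassicalSolution R T f u m where
  initial : ∀ x, m x 0 = m₀ x
  terminal : ∀ x, m x T = mT x

/-- `μ` is even, nonincreasing on `[0, R/2]` and nondecreasing on `[-R/2, 0]`. -/
structure IsEvenDecreasing (R : ℝ) (μ : ℝ → ℝ) : Prop where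
  even : ∀ x, μ (-x) = μ x
  antitoneOn : AntitoneOn μ (Icc 0 (R / 2))
  monotoneOn : MonotoneOn μ (Icc (-(R / 2)) 0)

/-- `γ` is the optimal trajectory of the value function `u` starting from `x` at time `0`:
`γ'(t) = -u_x(γ(t), t)` on `[0, T]` and `γ(0) = x`. -/
structure IsOptimalTrajectory (T : ℝ) (u : ℝ → ℝ → ℝ) (x : ℝ) (γ : ℝ → ℝ) : Prop where
  start : γ 0 = x
  flow : ∀ t ∈ Icc 0 T,
    HasDerivWithinAt γ (-deriv (fun y => u y t) (γ t)) (Icc 0 T) t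

open Filter Topology

/-! Label particles by the mass to their left. If `X(y, t)` is the position of the particle with
label `y`, then `X_y = 1/m`, `X_t = -u_x(X, t)` and `X_yy = -m_x/m³`. Differentiating the
Hamilton–Jacobi equation in space gives `X_tt = f'(m) m_x`, hence `X_tt + a(X_y) X_yy = 0` with
`a(q) = f'(1/q) q⁻³ ≥ 0`. All three conclusions come down to one fact: for each `t`, `X` is odd in
`y` and `X_yy ≥ 0` on the half period `[0, M/2]`, where `M` is the mass of a period. Then `m` is
even and decreasing, trajectories are concave, and in case (a) the terminal velocity `-g'(m) m_x` is
nonnegative, so velocities are nonnegative at all earlier times.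

Oddness and convexity follow from a maximum principle (`nonpos_of_second_deriv_nonneg_at_max`)
applied to `±(X(y) + X(-y))` and to `2 X(l) - X(l+s) - X(l-s)`. At a maximum in the space variables,
the first-order conditions make all the values of `X_y` involved equal. The coefficient `a` is then
the same at these points and the second-order condition gives the sign of the second time
derivative. Thus the equation is never linearized and no regularity beyond the existence of `f'`
enters there.

At time `T`, case (a) gives the Robin-type condition `X_t = b(X_y) X_yy` with `b(q) = g'(1/q) q⁻³ ≥
0`, handled by the same comparison. In case (b), evenness of `m(·, T)` gives oddness of `X(·, T)`
only up to a shift of the label, namely the net flux through the origin;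
`SolvesPlanning.massCoord_zero_terminal` excludes it by periodicity of `u`. -/

/-- The partial derivative of `w` in its first argument. -/
noncomputable def spaceDeriv (w : ℝ → ℝ → ℝ) (x t : ℝ) : ℝ := deriv (fun y => w y t) x

/-! ### Calculus on the closed slab `ℝ × [0, T]`. -/

theorem uniqueDiffOn_slab {T : ℝ} (hT : 0 < T) :
    UniqueDiffOn ℝ ((univ : Set ℝ) ×ˢ Icc 0 T) :=
  uniqueDiffOn_univ.prod (uniqueDiffOn_Icc hT)

theorem slab_mem_nhds {T t : ℝ} (ht : t ∈ Ioo 0 T) (x : ℝ) :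
    (univ : Set ℝ) ×ˢ Icc 0 T ∈ 𝓝 (x, t) :=
  prod_mem_nhds univ_mem (Icc_mem_nhds ht.1 ht.2)

theorem eventually_slab_interior {T t : ℝ} (ht : t ∈ Ioo 0 T) (x : ℝ) :
    ∀ᶠ p : ℝ × ℝ in 𝓝 (x, t), p.2 ∈ Ioo 0 T :=
  continuous_snd.continuousAt.eventually (Ioo_mem_nhds ht.1 ht.2)

theorem HasFDerivAt.hasDerivAt_fst {F : ℝ × ℝ → ℝ} {L : ℝ × ℝ →L[ℝ] ℝ} {x t : ℝ}
    (hF : HasFDerivAt F L (x, t)) : HasDerivAt (fun y => F (y, t)) (L (1, 0)) x :=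
  HasFDerivAt.comp_hasDerivAt (f := fun y => (y, t)) x hF
    ((hasDerivAt_id x).prodMk (hasDerivAt_const x t))

theorem HasFDerivAt.hasDerivAt_graph {F : ℝ × ℝ → ℝ} {L : ℝ × ℝ →L[ℝ] ℝ} {γ : ℝ → ℝ} {γ' t : ℝ}
    (hF : HasFDerivAt F L (γ t, t)) (hγ : HasDerivAt γ γ' t) :
    HasDerivAt (fun s => F (γ s, s)) (L (γ', 1)) t :=
  HasFDerivAt.comp_hasDerivAt (f := fun s => (γ s, s)) t hF (hγ.prodMk (hasDerivAt_id t))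

section Slab

variable {T : ℝ} {w : ℝ → ℝ → ℝ}

theorem hasDerivAt_slice (hw : ContDiffOn ℝ 1 (fun p : ℝ × ℝ => w p.1 p.2) (univ ×ˢ Icc 0 T))
    (x : ℝ) {t : ℝ} (ht : t ∈ Icc 0 T) :
    HasDerivAt (fun y => w y t)
      (fderivWithin ℝ (fun p : ℝ × ℝ => w p.1 p.2) (univ ×ˢ Icc 0 T) (x, t) (1, 0)) x := by
  have h := (hw.differentiableOn one_ne_zero (x, t) (mk_mem_prod (mem_univ x) ht)).hasFDerivWithinAt
  have hc : HasDerivWithinAt (fun y : ℝ => (y, t)) ((1 : ℝ), (0 : ℝ)) univ x :=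
    ((hasDerivAt_id x).prodMk (hasDerivAt_const x t)).hasDerivWithinAt
  have hmaps : MapsTo (fun y : ℝ => (y, t)) univ ((univ : Set ℝ) ×ˢ Icc 0 T) :=
    fun y _ => ⟨mem_univ y, ht⟩
  have hcomp := HasFDerivWithinAt.comp_hasDerivWithinAt x h hc hmaps
  exact hasDerivWithinAt_univ.1 hcomp

theorem spaceDeriv_eq (hw : ContDiffOn ℝ 1 (fun p : ℝ × ℝ => w p.1 p.2) (univ ×ˢ Icc 0 T))
    (x : ℝ) {t : ℝ} (ht : t ∈ Icc 0 T) :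
    spaceDeriv w x t =
      fderivWithin ℝ (fun p : ℝ × ℝ => w p.1 p.2) (univ ×ˢ Icc 0 T) (x, t) (1, 0) :=
  (hasDerivAt_slice hw x ht).deriv

theorem hasDerivAt_spaceDeriv
    (hw : ContDiffOn ℝ 1 (fun p : ℝ × ℝ => w p.1 p.2) (univ ×ˢ Icc 0 T))
    (x : ℝ) {t : ℝ} (ht : t ∈ Icc 0 T) :
    HasDerivAt (fun y => w y t) (spaceDeriv w x t) x :=
  (hasDerivAt_slice hw x ht).differentiableAt.hasDerivAt

theorem contDiffOn_spaceDeriv (hT : 0 < T) {k n : WithTop ℕ∞} (hkn : k + 1 ≤ n)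
    (hw : ContDiffOn ℝ n (fun p : ℝ × ℝ => w p.1 p.2) (univ ×ˢ Icc 0 T)) :
    ContDiffOn ℝ k (fun p : ℝ × ℝ => spaceDeriv w p.1 p.2) (univ ×ˢ Icc 0 T) := by
  have h := (hw.fderivWithin (uniqueDiffOn_slab hT) hkn).clm_apply
    (contDiffOn_const (c := ((1 : ℝ), (0 : ℝ))))
  refine h.congr fun p hp => ?_
  exact spaceDeriv_eq (hw.of_le (le_trans (by simp) hkn)) p.1 hp.2

theorem continuousOn_timeDeriv (hT : 0 < T)
    (hw : ContDiffOn ℝ 1 (fun p : ℝ × ℝ => w p.1 p.2) (univ ×ˢ Icc 0 T)) :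
    ContinuousOn (fun p : ℝ × ℝ =>
      fderivWithin ℝ (fun p : ℝ × ℝ => w p.1 p.2) (univ ×ˢ Icc 0 T) p (0, 1))
      (univ ×ˢ Icc 0 T) :=
  (hw.continuousOn_fderivWithin (uniqueDiffOn_slab hT) le_rfl).clm_apply continuousOn_const

theorem hasDerivAt_time (hw : ContDiffOn ℝ 1 (fun p : ℝ × ℝ => w p.1 p.2) (univ ×ˢ Icc 0 T))
    (x : ℝ) {t : ℝ} (ht : t ∈ Ioo 0 T) :
    HasDerivAt (fun s => w x s)
      (fderivWithin ℝ (fun p : ℝ × ℝ => w p.1 p.2) (univ ×ˢ Icc 0 T) (x, t) (0, 1)) t := by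
  have h := ((hw.differentiableOn one_ne_zero (x, t)
    ⟨mem_univ _, Ioo_subset_Icc_self ht⟩).hasFDerivWithinAt).hasFDerivAt (slab_mem_nhds ht x)
  exact h.hasDerivAt_graph (γ := fun _ => x) (hasDerivAt_const t x)

theorem continuous_slice (hw : ContinuousOn (fun p : ℝ × ℝ => w p.1 p.2) (univ ×ˢ Icc 0 T))
    {t : ℝ} (ht : t ∈ Icc 0 T) : Continuous fun x => w x t := by
  rw [← continuousOn_univ]
  exact hw.comp (f := fun x : ℝ => (x, t)) (by fun_prop) fun x _ => ⟨mem_univ _, ht⟩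

theorem continuousOn_time (hw : ContinuousOn (fun p : ℝ × ℝ => w p.1 p.2) (univ ×ˢ Icc 0 T))
    (x : ℝ) : ContinuousOn (fun t => w x t) (Icc 0 T) :=
  hw.comp (f := fun t : ℝ => (x, t)) (by fun_prop) fun t ht => ⟨mem_univ _, ht⟩

/-- Freezing the time variable outside `[0, T]` makes a function continuous on the slab
continuous. -/
theorem continuous_clamp (hT : 0 < T)
    (hw : ContinuousOn (fun p : ℝ × ℝ => w p.1 p.2) (univ ×ˢ Icc 0 T)) :
    Continuous fun p : ℝ × ℝ => w p.1 (projIcc 0 T hT.le p.2) := by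
  rw [← continuousOn_univ]
  refine hw.comp (f := fun p : ℝ × ℝ => (p.1, (projIcc 0 T hT.le p.2 : ℝ))) ?_
    fun p _ => ⟨mem_univ _, Subtype.coe_prop _⟩
  have : Continuous fun p : ℝ × ℝ => (p.1, (projIcc 0 T hT.le p.2 : ℝ)) :=
    continuous_fst.prodMk (continuous_subtype_val.comp (continuous_projIcc.comp continuous_snd))
  exact this.continuousOn

end Slab

/-! ### The flux, and the acceleration of optimal trajectories. -/

section Solution

variable {R T : ℝ} {f : ℝ → ℝ} {u m : ℝ → ℝ → ℝ}

theorem IsPositiveClassicalSolution.contDiffOn_ux (h : IsPositiveClassicalSolution R T f u m)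
    (hT : 0 < T) :
    ContDiffOn ℝ 1 (fun p : ℝ × ℝ => spaceDeriv u p.1 p.2) (univ ×ˢ Icc 0 T) :=
  contDiffOn_spaceDeriv hT (by norm_num) h.contDiffOn_u

theorem IsPositiveClassicalSolution.contDiffOn_flux (h : IsPositiveClassicalSolution R T f u m)
    (hT : 0 < T) :
    ContDiffOn ℝ 1 (fun p : ℝ × ℝ => m p.1 p.2 * spaceDeriv u p.1 p.2) (univ ×ˢ Icc 0 T) :=
  h.contDiffOn_m.mul (h.contDiffOn_ux hT)

theorem IsPositiveClassicalSolution.hasDerivAt_flux (h : IsPositiveClassicalSolution R T f u m)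
    (hT : 0 < T) (x : ℝ) {t : ℝ} (ht : t ∈ Ioo 0 T) :
    HasDerivAt (fun y => m y t * spaceDeriv u y t)
      (fderivWithin ℝ (fun p : ℝ × ℝ => m p.1 p.2) (univ ×ˢ Icc 0 T) (x, t) (0, 1)) x := by
  have h1 := hasDerivAt_spaceDeriv (w := fun x t => m x t * spaceDeriv u x t)
    (h.contDiffOn_flux hT) x (Ioo_subset_Icc_self ht)
  have h2 := h.continuity x t ht
  rw [(hasDerivAt_time h.contDiffOn_m x ht).deriv] at h2
  convert h1 using 1
  unfold spaceDeriv
  linarith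

/-- The acceleration of optimal trajectories. -/
theorem IsPositiveClassicalSolution.hasDerivAt_velocity
    (h : IsPositiveClassicalSolution R T f u m) (hf : ContDiffOn ℝ 1 f (Ioi 0))
    {γ : ℝ → ℝ} {t : ℝ} (ht : t ∈ Ioo 0 T) (hγ : HasDerivAt γ (-spaceDeriv u (γ t) t) t) :
    HasDerivAt (fun s => -spaceDeriv u (γ s) s)
      (deriv f (m (γ t) t) * spaceDeriv m (γ t) t) t := by
  set x := γ t with hx
  set U : ℝ × ℝ → ℝ := fun p => u p.1 p.2 with hU
  have htc := Ioo_subset_Icc_self ht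
  have hUat : ∀ p : ℝ × ℝ, p.2 ∈ Ioo 0 T → ContDiffAt ℝ 2 U p := fun p hp =>
    h.contDiffOn_u.contDiffAt (slab_mem_nhds hp p.1)
  have hdiff : ∀ p : ℝ × ℝ, p.2 ∈ Ioo 0 T → HasFDerivAt U (fderiv ℝ U p) p := fun p hp =>
    ((hUat p hp).differentiableAt two_ne_zero).hasFDerivAt
  have hsp : ∀ p : ℝ × ℝ, p.2 ∈ Ioo 0 T → fderiv ℝ U p (1, 0) = spaceDeriv u p.1 p.2 :=
    fun p hp => (hdiff p hp).hasDerivAt_fst.deriv.symm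
  have htm : ∀ p : ℝ × ℝ, p.2 ∈ Ioo 0 T →
      fderiv ℝ U p (0, 1) = 1 / 2 * spaceDeriv u p.1 p.2 ^ 2 - f (m p.1 p.2) := by
    intro p hp
    have h1 := ((hdiff p hp).hasDerivAt_graph (γ := fun _ => p.1) (t := p.2)
      (hasDerivAt_const p.2 p.1)).deriv
    have h2 := h.hamiltonJacobi p.1 p.2 hp
    have h3 : deriv (fun s => u p.1 s) p.2 = fderiv ℝ U p (0, 1) := h1
    rw [h3] at h2
    unfold spaceDeriv
    linarith
  set L := fderiv ℝ (fderiv ℝ U) (x, t) with hL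
  have hL' : HasFDerivAt (fderiv ℝ U) L (x, t) :=
    (((hUat (x, t) ht).fderiv_right (m := 1) (by norm_num)).differentiableAt
      one_ne_zero).hasFDerivAt
  have hsymm : L (1, 0) (0, 1) = L (0, 1) (1, 0) :=
    second_derivative_symmetric_of_eventually
      ((eventually_slab_interior ht x).mono fun p hp => hdiff p hp) hL' _ _
  have hspace : HasFDerivAt (fun p : ℝ × ℝ => spaceDeriv u p.1 p.2)
      (L.flip (1, 0)) (x, t) := by
    refine HasFDerivAt.congr_of_eventuallyEq ?_
      ((eventually_slab_interior ht x).mono fun p hp => (hsp p hp).symm)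
    exact (ContinuousLinearMap.apply ℝ ℝ ((1 : ℝ), (0 : ℝ))).hasFDerivAt.comp _ hL'
  have hslice : HasDerivAt (fun y => spaceDeriv u y t) (L (1, 0) (1, 0)) x :=
    hspace.hasDerivAt_fst
  have hm := hasDerivAt_spaceDeriv h.contDiffOn_m x htc
  have hfm : HasDerivAt (fun y => f (m y t)) (deriv f (m x t) * spaceDeriv m x t) x :=
    HasDerivAt.comp x ((hf.contDiffAt (Ioi_mem_nhds (h.pos x t htc))).differentiableAt
      one_ne_zero).hasDerivAt hm
  -- The Hamilton–Jacobi equation differentiated in space: `u_xt = u_x u_xx - f'(m) m_x`. Along the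
  -- flow the terms in `u_xx` cancel, so second derivatives of `u` suffice.
  have hmix : L (1, 0) (0, 1) =
      spaceDeriv u x t * L (1, 0) (1, 0) - deriv f (m x t) * spaceDeriv m x t := by
    have h1 : HasDerivAt (fun y => fderiv ℝ U (y, t) (0, 1)) (L (1, 0) (0, 1)) x := by
      have h0 : HasFDerivAt (fun p => fderiv ℝ U p (0, 1)) (L.flip (0, 1)) (x, t) :=
        (ContinuousLinearMap.apply ℝ ℝ ((0 : ℝ), (1 : ℝ))).hasFDerivAt.comp _ hL'
      exact h0.hasDerivAt_fst
    have h2 := ((hslice.pow 2).const_mul (1 / 2)).sub hfm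
    have h3 : (fun y => fderiv ℝ U (y, t) (0, 1)) =
        fun y => 1 / 2 * spaceDeriv u y t ^ 2 - f (m y t) :=
      funext fun y => htm (y, t) ht
    rw [h3] at h1
    have h4 := h1.unique h2
    rw [h4]
    simp
    ring
  have hc := (hspace.hasDerivAt_graph hγ).neg
  refine hc.congr_deriv ?_
  have hsplit : ((-spaceDeriv u x t, 1) : ℝ × ℝ) =
      (-spaceDeriv u x t) • ((1 : ℝ), (0 : ℝ)) + ((0 : ℝ), (1 : ℝ)) := by simp
  rw [hsplit, ContinuousLinearMap.flip_apply, map_add, map_smul, add_apply,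
    smul_apply, ← hsymm, hmix, smul_eq_mul]
  ring

end Solution

/-- A function continuous on `[0, T]` whose derivative in `(0, T)` extends continuously to `[0, T]`
is differentiable up to the end points. -/
theorem hasDerivWithinAt_Icc_of_continuousOn_deriv {T : ℝ} (hT : 0 < T) {φ v : ℝ → ℝ}
    (hφ : ContinuousOn φ (Icc 0 T)) (hv : ContinuousOn v (Icc 0 T))
    (hd : ∀ t ∈ Ioo 0 T, HasDerivAt φ (v t) t) {t : ℝ} (ht : t ∈ Icc 0 T) :
    HasDerivWithinAt φ (v t) (Icc 0 T) t := by
  have hc : Continuous (IccExtend hT.le (fun s : Icc 0 T => v s)) :=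
    (continuousOn_iff_continuous_domRestrict.1 hv).Icc_extend'
  have h1 : ∀ s ∈ Icc 0 T,
      φ s = φ 0 + ∫ τ in (0 : ℝ)..s, IccExtend hT.le (fun s : Icc 0 T => v s) τ := by
    intro s hs
    have h2 : ∫ τ in (0 : ℝ)..s, IccExtend hT.le (fun s : Icc 0 T => v s) τ = φ s - φ 0 := by
      refine intervalIntegral.integral_eq_sub_of_hasDerivAt_of_le hs.1
        (hφ.mono (Icc_subset_Icc_right hs.2)) (fun τ hτ => ?_) (hc.intervalIntegrable _ _)
      have hτ' : τ ∈ Ioo 0 T := ⟨hτ.1, hτ.2.trans_le hs.2⟩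
      rw [IccExtend_of_mem hT.le _ (Ioo_subset_Icc_self hτ')]
      exact hd τ hτ'
    rw [h2]; ring
  have h3 := (hc.integral_hasStrictDerivAt 0 t).hasDerivAt.const_add (φ 0)
  rw [IccExtend_of_mem hT.le _ ht] at h3
  exact h3.hasDerivWithinAt.congr (fun s hs => h1 s hs) (h1 t ht)

/-! ### The mass coordinate. -/

/-- The mass to the left of `x` at time `t`, up to the flux through the origin. -/
noncomputable def massCoord (u m : ℝ → ℝ → ℝ) (x t : ℝ) : ℝ :=
  (∫ s in (0 : ℝ)..x, m s t) + ∫ τ in (0 : ℝ)..t, m 0 τ * spaceDeriv u 0 τ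

/-- The position at time `t` of the particle with mass coordinate `y`. -/
noncomputable def position (u m : ℝ → ℝ → ℝ) (y t : ℝ) : ℝ :=
  Function.invFun (fun x => massCoord u m x t) y

section MassCoord

variable {R T : ℝ} {f : ℝ → ℝ} {u m : ℝ → ℝ → ℝ}

theorem IsPositiveClassicalSolution.hasDerivAt_massCoord
    (h : IsPositiveClassicalSolution R T f u m) (x : ℝ) {t : ℝ} (ht : t ∈ Icc 0 T) :
    HasDerivAt (fun y => massCoord u m y t) (m x t) x :=
  ((continuous_slice h.contDiffOn_m.continuousOn ht).integral_hasStrictDerivAt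
    0 x).hasDerivAt.add_const _

theorem IsPositiveClassicalSolution.continuousOn_massCoord
    (h : IsPositiveClassicalSolution R T f u m) (hT : 0 < T) :
    ContinuousOn (fun p : ℝ × ℝ => massCoord u m p.1 p.2) (univ ×ˢ Icc 0 T) := by
  have hm := continuous_clamp hT h.contDiffOn_m.continuousOn
  have hq := continuous_clamp (w := fun x t => m x t * spaceDeriv u x t) hT
    (h.contDiffOn_flux hT).continuousOn
  have h1 : Continuous fun p : ℝ × ℝ =>
      ∫ s in (0 : ℝ)..p.1, m s (projIcc 0 T hT.le p.2) :=
    intervalIntegral.continuous_parametric_intervalIntegral_of_continuous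
      (f := fun (p : ℝ × ℝ) s => m s (projIcc 0 T hT.le p.2))
      (hm.comp (continuous_snd.prodMk (continuous_snd.comp continuous_fst))) continuous_fst
  have h2 : Continuous fun p : ℝ × ℝ => ∫ τ in (0 : ℝ)..p.2,
      m 0 (projIcc 0 T hT.le τ) * spaceDeriv u 0 (projIcc 0 T hT.le τ) :=
    intervalIntegral.continuous_parametric_intervalIntegral_of_continuous
      (f := fun (_ : ℝ × ℝ) τ => m 0 (projIcc 0 T hT.le τ) *
        spaceDeriv u 0 (projIcc 0 T hT.le τ))
      (hq.comp (continuous_const.prodMk continuous_snd)) continuous_snd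
  refine (h1.add h2).continuousOn.congr fun p hp => ?_
  unfold massCoord
  congr 1
  · simp only [projIcc_of_mem hT.le hp.2]
  · refine intervalIntegral.integral_congr fun τ hτ => ?_
    rw [uIcc_of_le hp.2.1] at hτ
    have : τ ∈ Icc 0 T := ⟨hτ.1, hτ.2.trans hp.2.2⟩
    simp only [projIcc_of_mem hT.le this]

/-- Integrating `m_t = (m u_x)_x` from `0` to `x` leaves a boundary term at the origin; the flux
integral in `massCoord` cancels it. -/
theorem IsPositiveClassicalSolution.hasDerivAt_massCoord_time
    (h : IsPositiveClassicalSolution R T f u m) (hT : 0 < T) (x : ℝ) {t : ℝ} (ht : t ∈ Ioo 0 T) :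
    HasDerivAt (fun s => massCoord u m x s) (m x t * spaceDeriv u x t) t := by
  set mt : ℝ → ℝ → ℝ := fun s y =>
    fderivWithin ℝ (fun p : ℝ × ℝ => m p.1 p.2) (univ ×ˢ Icc 0 T) (y, s) (0, 1) with hmt
  have hmtc : ContinuousOn (fun p : ℝ × ℝ => mt p.2 p.1) (univ ×ˢ Icc 0 T) :=
    continuousOn_timeDeriv hT h.contDiffOn_m
  have htc := Ioo_subset_Icc_self ht
  have hcont : ∀ s ∈ Icc 0 T, Continuous (mt s) := fun s hs =>
    continuous_slice (w := fun y s => mt s y) hmtc hs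
  obtain ⟨C, hC⟩ := (isCompact_uIcc (a := (0 : ℝ)) (b := x)).prod
    (isCompact_Icc (a := (0 : ℝ)) (b := T)) |>.exists_bound_of_continuousOn
    (hmtc.mono (prod_mono_left (subset_univ _)))
  have h1 : HasDerivAt (fun s => ∫ y in (0 : ℝ)..x, m y s) (∫ y in (0 : ℝ)..x, mt t y) t := by
    refine (intervalIntegral.hasDerivAt_integral_of_dominated_loc_of_deriv_le
      (F := fun s y => m y s) (F' := mt) (s := Ioo 0 T) (bound := fun _ => C)
      (Ioo_mem_nhds ht.1 ht.2) ?_ ?_ ?_ ?_ ?_ ?_).2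
    · filter_upwards [Icc_mem_nhds ht.1 ht.2] with s hs
      exact (continuous_slice h.contDiffOn_m.continuousOn hs).aestronglyMeasurable
    · exact (continuous_slice h.contDiffOn_m.continuousOn htc).intervalIntegrable _ _
    · exact (hcont t htc).aestronglyMeasurable
    · exact .of_forall fun y hy s hs =>
        hC (y, s) ⟨uIoc_subset_uIcc hy, Ioo_subset_Icc_self hs⟩
    · exact intervalIntegrable_const
    · exact .of_forall fun y _ s hs => hasDerivAt_time h.contDiffOn_m y hs
  have h2 : ∫ y in (0 : ℝ)..x, mt t y = m x t * spaceDeriv u x t - m 0 t * spaceDeriv u 0 t :=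
    intervalIntegral.integral_eq_sub_of_hasDerivAt (fun y _ => h.hasDerivAt_flux hT y ht)
      ((hcont t htc).intervalIntegrable _ _)
  have hq := continuousOn_time (w := fun x t => m x t * spaceDeriv u x t)
    (h.contDiffOn_flux hT).continuousOn 0
  have h3 : HasDerivAt (fun s => ∫ τ in (0 : ℝ)..s, m 0 τ * spaceDeriv u 0 τ)
      (m 0 t * spaceDeriv u 0 t) t := by
    refine intervalIntegral.integral_hasDerivAt_right ?_ ?_ ?_
    · refine (hq.mono ?_).intervalIntegrable
      rw [uIcc_of_le ht.1.le]
      exact Icc_subset_Icc_right ht.2.le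
    · exact (hq.mono Ioo_subset_Icc_self).stronglyMeasurableAtFilter isOpen_Ioo t ht
    · exact hq.continuousAt (Icc_mem_nhds ht.1 ht.2)
  have := h1.add h3
  rw [h2] at this
  exact this.congr_deriv (by ring)

/-- Both partial derivatives, `m` and `m u_x`, are continuous. -/
theorem IsPositiveClassicalSolution.hasFDerivAt_massCoord
    (h : IsPositiveClassicalSolution R T f u m) (hT : 0 < T) (x : ℝ) {t : ℝ} (ht : t ∈ Ioo 0 T) :
    HasFDerivAt (fun p : ℝ × ℝ => massCoord u m p.1 p.2)
      (m x t • ContinuousLinearMap.fst ℝ ℝ ℝ +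
        (m x t * spaceDeriv u x t) • ContinuousLinearMap.snd ℝ ℝ ℝ) (x, t) := by
  have hm : ContinuousAt (fun p : ℝ × ℝ => m p.1 p.2) (x, t) :=
    h.contDiffOn_m.continuousOn.continuousAt (slab_mem_nhds ht x)
  have hq : ContinuousAt (fun p : ℝ × ℝ => m p.1 p.2 * spaceDeriv u p.1 p.2) (x, t) :=
    (h.contDiffOn_flux hT).continuousOn.continuousAt (slab_mem_nhds ht x)
  have key := hasStrictFDerivAt_uncurry_coprod (𝕜 := ℝ) (u := (x, t)) (f := massCoord u m)
    (f₁ := fun x t => ContinuousLinearMap.toSpanSingleton ℝ (m x t))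
    (f₂ := fun x t => ContinuousLinearMap.toSpanSingleton ℝ (m x t * spaceDeriv u x t))
    ((eventually_slab_interior ht x).mono fun p hp =>
      (h.hasDerivAt_massCoord p.1 (Ioo_subset_Icc_self hp)).hasFDerivAt)
    ((eventually_slab_interior ht x).mono fun p hp =>
      (h.hasDerivAt_massCoord_time hT p.1 hp).hasFDerivAt)
    ((ContinuousLinearMap.toSpanSingletonCLE (𝕜 := ℝ) (E := ℝ)).continuous.continuousAt.comp hm)
    ((ContinuousLinearMap.toSpanSingletonCLE (𝕜 := ℝ) (E := ℝ)).continuous.continuousAt.comp hq)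
  refine key.hasFDerivAt.congr_fderiv ?_
  ext <;> simp [Function.HasUncurry.uncurry]

end MassCoord

theorem eq_left_of_hasDerivAt_zero {T : ℝ} {φ : ℝ → ℝ} (hφ : ContinuousOn φ (Icc 0 T))
    (hd : ∀ t ∈ Ioo 0 T, HasDerivAt φ 0 t) {t : ℝ} (ht : t ∈ Icc 0 T) : φ t = φ 0 := by
  have := intervalIntegral.integral_eq_sub_of_hasDerivAt_of_le ht.1
    (hφ.mono (Icc_subset_Icc_right ht.2)) (fun s hs => hd s ⟨hs.1, hs.2.trans_le ht.2⟩)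
    intervalIntegrable_const
  simp at this
  linarith

theorem eq_of_hasDerivAt_zero {φ : ℝ → ℝ} (hd : ∀ x, HasDerivAt φ 0 x) (x y : ℝ) : φ x = φ y :=
  is_const_of_deriv_eq_zero (fun x => (hd x).differentiableAt) (fun x => (hd x).deriv) x y

/-! ### The inverse of the mass coordinate: particle positions. -/

section Position

variable {R T : ℝ} {f : ℝ → ℝ} {u m : ℝ → ℝ → ℝ}

theorem IsPositiveClassicalSolution.periodic_ux (h : IsPositiveClassicalSolution R T f u m)
    {t : ℝ} (ht : t ∈ Icc 0 T) (x : ℝ) : spaceDeriv u (x + R) t = spaceDeriv u x t := by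
  have := deriv_comp_add_const (f := fun y => u y t) R x
  unfold spaceDeriv
  rw [← this]
  congr 1
  exact funext (h.periodic_u t ht)

/-- The increment over a period depends neither on `x` (periodicity of `m`) nor on `t` (equal fluxes
at both ends). -/
theorem IsPositiveClassicalSolution.massCoord_add_period
    (h : IsPositiveClassicalSolution R T f u m) (hT : 0 < T) {t : ℝ} (ht : t ∈ Icc 0 T) (x : ℝ) :
    massCoord u m (x + R) t = massCoord u m x t + massCoord u m R 0 := by
  have h1 : ∀ y, HasDerivAt (fun x => massCoord u m (x + R) t - massCoord u m x t) 0 y := by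
    intro y
    have := ((h.hasDerivAt_massCoord (y + R) ht).comp_add_const y R).sub
      (h.hasDerivAt_massCoord y ht)
    exact this.congr_deriv (sub_eq_zero.2 (h.periodic_m t ht y))
  have h2 := eq_of_hasDerivAt_zero h1 x 0
  have hc := fun x => continuousOn_time (w := massCoord u m) (h.continuousOn_massCoord hT) x
  have h3 := eq_left_of_hasDerivAt_zero (T := T) ((hc (0 + R)).sub (hc 0)) (fun s hs => by
    have h4 := (h.hasDerivAt_massCoord_time hT (0 + R) hs).sub
      (h.hasDerivAt_massCoord_time hT 0 hs)
    refine h4.congr_deriv (sub_eq_zero.2 ?_)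
    have hm : m (0 + R) s = m 0 s := h.periodic_m s (Ioo_subset_Icc_self hs) 0
    rw [hm, h.periodic_ux (Ioo_subset_Icc_self hs)]) ht
  have h5 : massCoord u m 0 0 = 0 := by simp [massCoord]
  simp only [zero_add, Pi.sub_apply] at h2 h3
  linarith

theorem IsPositiveClassicalSolution.strictMono_massCoord
    (h : IsPositiveClassicalSolution R T f u m) {t : ℝ} (ht : t ∈ Icc 0 T) :
    StrictMono fun x => massCoord u m x t :=
  strictMono_of_deriv_pos fun x => by
    rw [(h.hasDerivAt_massCoord x ht).deriv]
    exact h.pos x t ht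

theorem IsPositiveClassicalSolution.period_pos
    (h : IsPositiveClassicalSolution R T f u m) (hR : 0 < R) (hT : 0 < T) :
    0 < massCoord u m R 0 := by
  have := h.strictMono_massCoord (left_mem_Icc.2 hT.le) hR
  simpa [massCoord] using this

theorem IsPositiveClassicalSolution.massCoord_add_nat_mul
    (h : IsPositiveClassicalSolution R T f u m) (hT : 0 < T) {t : ℝ} (ht : t ∈ Icc 0 T) (n : ℕ)
    (x : ℝ) : massCoord u m (x + n * R) t = massCoord u m x t + n * massCoord u m R 0 := by
  induction n with
  | zero => simp
  | succ n ih =>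
    have := h.massCoord_add_period hT ht (x + n * R)
    push_cast
    rw [show x + ((n : ℝ) + 1) * R = x + n * R + R by ring, this, ih]
    ring

/-- Each period adds the same positive mass, so the coordinate is unbounded in both directions. -/
theorem IsPositiveClassicalSolution.surjective_massCoord
    (h : IsPositiveClassicalSolution R T f u m) (hR : 0 < R) (hT : 0 < T) {t : ℝ}
    (ht : t ∈ Icc 0 T) : Function.Surjective fun x => massCoord u m x t := by
  intro y
  have hM := h.period_pos hR hT
  obtain ⟨n, hn⟩ := exists_nat_ge (|y - massCoord u m 0 t| / massCoord u m R 0)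
  rw [div_le_iff₀ hM, abs_le] at hn
  have h1 := h.massCoord_add_nat_mul hT ht n 0
  have h2 := h.massCoord_add_nat_mul hT ht n (-(n * R))
  rw [neg_add_cancel] at h2
  rw [zero_add] at h1
  have hc : Continuous fun x => massCoord u m x t :=
    continuous_iff_continuousAt.2 fun x => (h.hasDerivAt_massCoord x ht).continuousAt
  have hle : -(n * R) ≤ n * R := by
    have : 0 ≤ n * R := by positivity
    linarith
  obtain ⟨x, -, hx⟩ := intermediate_value_Icc hle hc.continuousOn
    (show y ∈ Icc (massCoord u m (-(n * R)) t) (massCoord u m (n * R) t) from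
      ⟨by linarith, by linarith⟩)
  exact ⟨x, hx⟩

theorem IsPositiveClassicalSolution.massCoord_position
    (h : IsPositiveClassicalSolution R T f u m) (hR : 0 < R) (hT : 0 < T) {t : ℝ}
    (ht : t ∈ Icc 0 T) (y : ℝ) : massCoord u m (position u m y t) t = y :=
  Function.invFun_eq (f := fun x => massCoord u m x t) (h.surjective_massCoord hR hT ht y)

theorem IsPositiveClassicalSolution.position_massCoord
    (h : IsPositiveClassicalSolution R T f u m) {t : ℝ} (ht : t ∈ Icc 0 T) (x : ℝ) :
    position u m (massCoord u m x t) t = x :=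
  Function.leftInverse_invFun (h.strictMono_massCoord ht).injective x

theorem IsPositiveClassicalSolution.position_eq
    (h : IsPositiveClassicalSolution R T f u m) {t x y : ℝ} (ht : t ∈ Icc 0 T)
    (hx : massCoord u m x t = y) : position u m y t = x := by
  rw [← hx, h.position_massCoord ht]

theorem IsPositiveClassicalSolution.strictMono_position
    (h : IsPositiveClassicalSolution R T f u m) (hR : 0 < R) (hT : 0 < T) {t : ℝ}
    (ht : t ∈ Icc 0 T) : StrictMono fun y => position u m y t := by
  intro y z hyz
  rw [← (h.strictMono_massCoord ht).lt_iff_lt]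
  simpa only [h.massCoord_position hR hT ht] using hyz

theorem IsPositiveClassicalSolution.position_add_period
    (h : IsPositiveClassicalSolution R T f u m) (hR : 0 < R) (hT : 0 < T) {t : ℝ}
    (ht : t ∈ Icc 0 T) (y : ℝ) :
    position u m (y + massCoord u m R 0) t = position u m y t + R :=
  h.position_eq ht (by rw [h.massCoord_add_period hT ht, h.massCoord_position hR hT ht])

/-- By monotonicity, comparing the position with `a` amounts to comparing the label with the mass
coordinate of `a`, which is continuous in time. -/
theorem IsPositiveClassicalSolution.continuousOn_position
    (h : IsPositiveClassicalSolution R T f u m) (hR : 0 < R) (hT : 0 < T) :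
    ContinuousOn (fun p : ℝ × ℝ => position u m p.1 p.2) (univ ×ˢ Icc 0 T) := by
  rintro ⟨y, t⟩ ⟨-, ht⟩
  have hN : ∀ x, Tendsto (fun p : ℝ × ℝ => massCoord u m x p.2)
      (𝓝[univ ×ˢ Icc 0 T] (y, t)) (𝓝 (massCoord u m x t)) := by
    intro x
    have h1 := continuousOn_time (w := massCoord u m) (h.continuousOn_massCoord hT) x t ht
    refine h1.tendsto.comp (tendsto_nhdsWithin_iff.2 ⟨?_, ?_⟩)
    · exact continuous_snd.continuousAt.mono_left nhdsWithin_le_nhds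
    · exact eventually_mem_nhdsWithin.mono fun p hp => hp.2
  have hy : Tendsto (fun p : ℝ × ℝ => p.1) (𝓝[univ ×ˢ Icc 0 T] (y, t)) (𝓝 y) :=
    continuous_fst.continuousAt.mono_left nhdsWithin_le_nhds
  have hself := h.massCoord_position hR hT ht y
  refine tendsto_order.2 ⟨fun a ha => ?_, fun a ha => ?_⟩
  · have h1 : massCoord u m a t < y := by
      rw [← hself]; exact h.strictMono_massCoord ht ha
    filter_upwards [(hN a).eventually_lt hy h1, eventually_mem_nhdsWithin] with p hp hp'
    rw [← (h.strictMono_massCoord hp'.2).lt_iff_lt]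
    simpa only [h.massCoord_position hR hT hp'.2] using hp
  · have h1 : y < massCoord u m a t := by
      conv_lhs => rw [← hself]
      exact h.strictMono_massCoord ht ha
    filter_upwards [hy.eventually_lt (hN a) h1, eventually_mem_nhdsWithin] with p hp hp'
    rw [← (h.strictMono_massCoord hp'.2).lt_iff_lt]
    simpa only [h.massCoord_position hR hT hp'.2] using hp

theorem IsPositiveClassicalSolution.hasDerivAt_position
    (h : IsPositiveClassicalSolution R T f u m) (hR : 0 < R) (hT : 0 < T) {t : ℝ}
    (ht : t ∈ Icc 0 T) (y : ℝ) :
    HasDerivAt (fun y => position u m y t) (m (position u m y t) t)⁻¹ y :=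
  HasDerivAt.of_local_left_inverse (f := fun x => massCoord u m x t)
    (continuous_slice (w := position u m) (h.continuousOn_position hR hT) ht).continuousAt
    (h.hasDerivAt_massCoord _ ht) (h.pos _ t ht).ne'
    (.of_forall (h.massCoord_position hR hT ht))

theorem IsPositiveClassicalSolution.hasDerivAt_position_time_of_mem_Ioo
    (h : IsPositiveClassicalSolution R T f u m) (hR : 0 < R) (hT : 0 < T) (y : ℝ) {t : ℝ}
    (ht : t ∈ Ioo 0 T) :
    HasDerivAt (fun s => position u m y s) (-spaceDeriv u (position u m y t) t) t := by
  set x := position u m y t with hx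
  have hm : m x t ≠ 0 := (h.pos x t (Ioo_subset_Icc_self ht)).ne'
  -- The derivative of `(x, t) ↦ (massCoord x t, t)` is triangular with diagonal `m, 1`. Its inverse
  -- is written out, and its entry `-u_x` is the velocity sought.
  set Φ : (ℝ × ℝ) ≃L[ℝ] (ℝ × ℝ) := ContinuousLinearEquiv.equivOfInverse
    ((m x t • ContinuousLinearMap.fst ℝ ℝ ℝ +
        (m x t * spaceDeriv u x t) • ContinuousLinearMap.snd ℝ ℝ ℝ).prod
      (ContinuousLinearMap.snd ℝ ℝ ℝ))
    (((m x t)⁻¹ • ContinuousLinearMap.fst ℝ ℝ ℝ -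
        spaceDeriv u x t • ContinuousLinearMap.snd ℝ ℝ ℝ).prod
      (ContinuousLinearMap.snd ℝ ℝ ℝ))
    (fun p => by ext <;> simp; field_simp; ring)
    (fun p => by ext <;> simp; field_simp; ring) with hΦ
  have hfd : HasFDerivAt (fun p : ℝ × ℝ => (massCoord u m p.1 p.2, p.2))
      (Φ : ℝ × ℝ →L[ℝ] ℝ × ℝ) (position u m y t, t) :=
    (h.hasFDerivAt_massCoord hT x ht).prodMk hasFDerivAt_snd
  have hcont : ContinuousAt (fun p : ℝ × ℝ => (position u m p.1 p.2, p.2)) (y, t) :=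
    ((h.continuousOn_position hR hT).continuousAt (slab_mem_nhds ht y)).prodMk
      continuousAt_snd
  have hinv := HasFDerivAt.of_local_left_inverse
    (g := fun p : ℝ × ℝ => (position u m p.1 p.2, p.2)) hcont hfd
    ((eventually_slab_interior ht y).mono fun p hp => by
      simp only [h.massCoord_position hR hT (Ioo_subset_Icc_self hp)])
  have := (hinv.fst).hasDerivAt_graph (γ := fun _ => y) (hasDerivAt_const t y)
  refine this.congr_deriv ?_
  simp [hΦ]

theorem IsPositiveClassicalSolution.continuousOn_velocity
    (h : IsPositiveClassicalSolution R T f u m) (hT : 0 < T) {γ : ℝ → ℝ}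
    (hγ : ContinuousOn γ (Icc 0 T)) :
    ContinuousOn (fun t => -spaceDeriv u (γ t) t) (Icc 0 T) :=
  ((h.contDiffOn_ux hT).continuousOn.comp (f := fun t => (γ t, t)) (hγ.prodMk continuousOn_id)
    fun _ ht => ⟨mem_univ _, ht⟩).neg

theorem IsPositiveClassicalSolution.hasDerivWithinAt_position_time
    (h : IsPositiveClassicalSolution R T f u m) (hR : 0 < R) (hT : 0 < T) (y : ℝ) {t : ℝ}
    (ht : t ∈ Icc 0 T) :
    HasDerivWithinAt (fun s => position u m y s) (-spaceDeriv u (position u m y t) t)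
      (Icc 0 T) t := by
  have hc := continuousOn_time (w := position u m) (h.continuousOn_position hR hT) y
  exact hasDerivWithinAt_Icc_of_continuousOn_deriv hT
    (v := fun t => -spaceDeriv u (position u m y t) t) hc (h.continuousOn_velocity hT hc)
    (fun s hs => h.hasDerivAt_position_time_of_mem_Ioo hR hT y hs) ht

/-- The mass coordinate is constant along an optimal trajectory, since `m γ' + m u_x = 0`. -/
theorem IsPositiveClassicalSolution.eq_position_of_isOptimalTrajectory
    (h : IsPositiveClassicalSolution R T f u m) (hT : 0 < T) {x : ℝ}
    {γ : ℝ → ℝ} (hγ : IsOptimalTrajectory T u x γ) {t : ℝ} (ht : t ∈ Icc 0 T) :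
    γ t = position u m (massCoord u m x 0) t := by
  have hc : ContinuousOn γ (Icc 0 T) := fun s hs => (hγ.flow s hs).continuousWithinAt
  have h1 : ContinuousOn (fun s => massCoord u m (γ s) s) (Icc 0 T) :=
    (h.continuousOn_massCoord hT).comp (f := fun t => (γ t, t)) (hc.prodMk continuousOn_id)
      fun _ ht => ⟨mem_univ _, ht⟩
  have h2 := eq_left_of_hasDerivAt_zero h1 (fun s hs => by
    have hd := (hγ.flow s (Ioo_subset_Icc_self hs)).hasDerivAt (Icc_mem_nhds hs.1 hs.2)
    refine ((h.hasFDerivAt_massCoord hT (γ s) hs).hasDerivAt_graph hd).congr_deriv ?_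
    simp [spaceDeriv]) ht
  simp only [hγ.start] at h2
  exact (h.position_eq ht h2).symm

end Position

/-! ### One-variable extremum tests and the maximum principle. -/

/-- If `c > 0`, the point is also a local minimum, so `φ` is locally constant and `c = 0`. -/
theorem IsLocalMax.second_deriv_nonpos {φ φ' : ℝ → ℝ} {c t : ℝ} (hmax : IsLocalMax φ t)
    (h1 : ∀ᶠ s in 𝓝 t, HasDerivAt φ (φ' s) s) (h2 : HasDerivAt φ' c t) : c ≤ 0 := by
  by_contra! hc
  have hd : deriv φ =ᶠ[𝓝 t] φ' := h1.mono fun s hs => hs.deriv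
  have hmin : IsLocalMin φ t := by
    refine isLocalMin_of_deriv_deriv_pos ?_ hmax.deriv_eq_zero h1.self_of_nhds.continuousAt
    rwa [hd.deriv_eq, h2.deriv]
  have hconst : φ =ᶠ[𝓝 t] fun _ => φ t := by
    filter_upwards [hmax, hmin] with s hs hs'
    exact le_antisymm hs hs'
  have h3 : φ' =ᶠ[𝓝 t] fun _ => (0 : ℝ) := by
    refine hd.symm.trans (hconst.deriv.trans ?_)
    simp
  have := (h2.congr_of_eventuallyEq h3.symm).unique (hasDerivAt_const t (0 : ℝ))
  exact hc.ne' this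

theorem HasDerivWithinAt.nonneg_of_isMaxOn_right {T d : ℝ} (hT : 0 < T) {φ : ℝ → ℝ}
    (h : HasDerivWithinAt φ d (Icc 0 T) T) (hmax : IsMaxOn φ (Icc 0 T) T) : 0 ≤ d := by
  by_contra! hd
  rw [hasDerivWithinAt_iff_tendsto_slope] at h
  have hev := h.eventually_lt_const hd
  have hne : (𝓝[Icc 0 T \ {T}] T).NeBot := by
    rw [Icc_sdiff_right, nhdsWithin_Ico_eq_nhdsLT hT]
    infer_instance
  obtain ⟨s, hs, hs'⟩ := (hev.and eventually_mem_nhdsWithin).exists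
  have hlt : s < T := lt_of_le_of_ne hs'.1.2 hs'.2
  have h1 : φ s ≤ φ T := hmax hs'.1
  rw [slope_def_field] at hs
  exact absurd hs (not_lt.2 (div_nonneg_of_nonpos (by linarith) (by linarith)))

theorem HasDerivWithinAt.le_left_of_mul_le {T d e : ℝ} (hT : 0 < T) {φ : ℝ → ℝ}
    (h : HasDerivWithinAt φ d (Icc 0 T) 0) (h0 : φ 0 = 0) (hle : ∀ t ∈ Icc 0 T, e * t ≤ φ t) :
    e ≤ d := by
  rw [hasDerivWithinAt_iff_tendsto_slope] at h
  have hne : (𝓝[Icc 0 T \ {0}] (0 : ℝ)).NeBot := by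
    rw [Icc_sdiff_left, nhdsWithin_Ioc_eq_nhdsGT hT]
    infer_instance
  refine ge_of_tendsto h (eventually_mem_nhdsWithin.mono fun t ht => ?_)
  have hpos : 0 < t := lt_of_le_of_ne ht.1.1 (Ne.symm ht.2)
  rw [slope_def_field, h0, sub_zero, sub_zero, le_div_iff₀ hpos]
  exact hle t ht.1

/-- A maximum principle on `K × [0, T]`: it is enough to control the second time derivative at
the points that maximize `W` at a fixed time. -/
theorem nonpos_of_second_deriv_nonneg_at_max {P : Type*} [TopologicalSpace P] {K : Set P}
    (hK : IsCompact K) {T : ℝ} (hT : 0 < T) {W W' : P → ℝ → ℝ}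
    (hcont : ContinuousOn (fun z : P × ℝ => W z.1 z.2) (K ×ˢ Icc 0 T))
    (hderiv : ∀ p ∈ K, ∀ t ∈ Icc 0 T, HasDerivWithinAt (W p) (W' p t) (Icc 0 T) t)
    (hsecond : ∀ p ∈ K, ∀ t ∈ Ioo 0 T, IsMaxOn (fun q => W q t) K p → 0 < W p t →
      ∃ c, 0 ≤ c ∧ HasDerivAt (W' p) c t)
    (hinit : ∀ p ∈ K, W p 0 ≤ 0)
    (hterm : ∀ p ∈ K, IsMaxOn (fun q => W q T) K p → 0 < W p T → W' p T ≤ 0) :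
    ∀ p ∈ K, ∀ t ∈ Icc 0 T, W p t ≤ 0 := by
  intro p₀ hp₀ t₀ ht₀
  by_contra! hpos
  -- The barrier `ε t (3T - t)` is strictly concave, which makes an interior maximum of the
  -- difference impossible, and still has slope `εT > 0` at `T`, which excludes a maximum there. It
  -- stays below `3εT²`, so the difference remains positive at `(p₀, t₀)`.
  set ε := W p₀ t₀ / (3 * T ^ 2) with hε
  have hεpos : 0 < ε := by positivity
  have hεT : ε * (3 * T ^ 2) = W p₀ t₀ := by rw [hε]; field_simp
  have hcG : ContinuousOn (fun z : P × ℝ => W z.1 z.2 - ε * (z.2 * (3 * T - z.2)))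
      (K ×ˢ Icc 0 T) := hcont.sub (by fun_prop)
  obtain ⟨⟨p, t⟩, ⟨hp, ht⟩, hmax⟩ := (hK.prod isCompact_Icc).exists_isMaxOn
    ⟨(p₀, t₀), hp₀, ht₀⟩ hcG
  have hmax' : ∀ q ∈ K, ∀ s ∈ Icc 0 T,
      W q s - ε * (s * (3 * T - s)) ≤ W p t - ε * (t * (3 * T - t)) :=
    fun q hq s hs => hmax (show (q, s) ∈ K ×ˢ Icc 0 T from ⟨hq, hs⟩)
  have hG : 0 < W p t - ε * (t * (3 * T - t)) := by
    refine lt_of_lt_of_le ?_ (hmax' p₀ hp₀ t₀ ht₀)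
    have : t₀ * (3 * T - t₀) < 3 * T ^ 2 := by nlinarith [ht₀.1, ht₀.2]
    nlinarith
  have hψ : 0 ≤ ε * (t * (3 * T - t)) :=
    mul_nonneg hεpos.le (mul_nonneg ht.1 (by linarith [ht.2]))
  have hWpos : 0 < W p t := by linarith
  have hslice : IsMaxOn (fun q => W q t) K p := fun q hq => by
    have := hmax' q hq t ht
    show W q t ≤ W p t
    linarith
  have hψd : ∀ s, HasDerivAt (fun s => ε * (s * (3 * T - s))) (ε * (3 * T - 2 * s)) s := by
    intro s
    have := ((hasDerivAt_id s).mul ((hasDerivAt_id s).const_sub (3 * T))).const_mul ε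
    refine this.congr_deriv ?_
    simp only [id]
    ring
  have ht0 : 0 < t := by
    refine lt_of_le_of_ne ht.1 fun h0 => ?_
    have := hinit p hp
    rw [h0] at this
    linarith
  rcases ht.2.eq_or_lt with rfl | htT
  · have h1 := (hderiv p hp t ht).sub (hψd t).hasDerivWithinAt
    have h2 := HasDerivWithinAt.nonneg_of_isMaxOn_right hT h1 fun s hs => hmax' p hp s hs
    have h3 := hterm p hp hslice hWpos
    nlinarith
  · obtain ⟨c, hc, hcd⟩ := hsecond p hp t ⟨ht0, htT⟩ hslice hWpos
    have hloc : IsLocalMax (fun s => W p s - ε * (s * (3 * T - s))) t := by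
      filter_upwards [Icc_mem_nhds ht0 htT] with s hs using hmax' p hp s hs
    have h1 : ∀ᶠ s in 𝓝 t, HasDerivAt (fun s => W p s - ε * (s * (3 * T - s)))
        (W' p s - ε * (3 * T - 2 * s)) s := by
      filter_upwards [Ioo_mem_nhds ht0 htT] with s hs
      exact ((hderiv p hp s (Ioo_subset_Icc_self hs)).hasDerivAt
        (Icc_mem_nhds hs.1 hs.2)).sub (hψd s)
    have h2 : HasDerivAt (fun s => W' p s - ε * (3 * T - 2 * s)) (c + 2 * ε) t := by
      have := hcd.sub ((((hasDerivAt_id t).const_mul 2).const_sub (3 * T)).const_mul ε)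
      refine this.congr_deriv ?_
      ring
    have := IsLocalMax.second_deriv_nonpos hloc h1 h2
    linarith

/-! ### Comparison principles for the degenerate elliptic equation. -/

/-- A one-dimensional motion `X`, in mass coordinates, with deformation `q = X_y` and velocity
`V = X_t`, subject to the degenerate elliptic equation `X_tt + a(X_y) X_yy = 0`. -/
structure IsEllipticMotion (R T M : ℝ) (a : ℝ → ℝ) (X q A V : ℝ → ℝ → ℝ) : Prop where
  continuousOn : ContinuousOn (fun p : ℝ × ℝ => X p.1 p.2) (univ ×ˢ Icc 0 T)
  hasDerivAt_space : ∀ t ∈ Icc 0 T, ∀ y, HasDerivAt (fun y => X y t) (q y t) y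
  hasDerivAt_deformation : ∀ t ∈ Icc 0 T, ∀ y, HasDerivAt (fun y => q y t) (A y t) y
  hasDerivWithinAt_time : ∀ t ∈ Icc 0 T, ∀ y,
    HasDerivWithinAt (fun s => X y s) (V y t) (Icc 0 T) t
  hasDerivAt_velocity : ∀ t ∈ Ioo 0 T, ∀ y,
    HasDerivAt (fun s => V y s) (-(a (q y t) * A y t)) t
  nonneg : ∀ t ∈ Ioo 0 T, ∀ y, 0 ≤ a (q y t)
  add_period : ∀ t ∈ Icc 0 T, ∀ y, X (y + M) t = X y t + R

namespace IsEllipticMotion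

variable {R T M : ℝ} {a : ℝ → ℝ} {X q A V : ℝ → ℝ → ℝ}

theorem sub_period (h : IsEllipticMotion R T M a X q A V) {t : ℝ} (ht : t ∈ Icc 0 T) (y : ℝ) :
    X (y - M) t = X y t - R := by
  have := h.add_period t ht (y - M)
  rw [sub_add_cancel] at this
  linarith

/-- At a maximum of `σ (X(y) + X(-y))`, the deformations at `y` and `-y` agree. -/
theorem reflection_at_max (h : IsEllipticMotion R T M a X q A V) (hM : 0 < M) {t : ℝ}
    (ht : t ∈ Icc 0 T) {σ y : ℝ} (hσ : σ ≠ 0)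
    (hmax : IsMaxOn (fun y => σ * (X y t + X (-y) t)) (Icc 0 M) y) :
    q (-y) t = q y t ∧ σ * (A y t + A (-y) t) ≤ 0 := by
  have hper : Function.Periodic (fun y => σ * (X y t + X (-y) t)) M := by
    intro y
    have h1 := h.sub_period ht (-y)
    have h2 := h.add_period t ht y
    simp only [show -(y + M) = -y - M by ring, h1, h2]
    ring
  -- By periodicity a maximum over `[0, M]` is global, so the end points of the interval need no
  -- separate treatment.
  have hglob : ∀ z, σ * (X z t + X (-z) t) ≤ σ * (X y t + X (-y) t) := by
    intro z
    obtain ⟨z', hz', hzz⟩ := hper.exists_mem_Ico₀ hM z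
    rw [show σ * (X z t + X (-z) t) = σ * (X z' t + X (-z') t) from hzz]
    exact hmax (Ico_subset_Icc_self hz')
  have hloc : IsLocalMax (fun y => σ * (X y t + X (-y) t)) y := .of_forall hglob
  have hd : ∀ z, HasDerivAt (fun y => σ * (X y t + X (-y) t)) (σ * (q z t - q (-z) t)) z := by
    intro z
    have h1 := (h.hasDerivAt_space t ht (-z)).comp z (hasDerivAt_neg z)
    refine (((h.hasDerivAt_space t ht z).add h1).const_mul σ).congr_deriv ?_
    ring
  have hd2 : HasDerivAt (fun z => σ * (q z t - q (-z) t)) (σ * (A y t + A (-y) t)) y := by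
    have h1 := (h.hasDerivAt_deformation t ht (-y)).comp y (hasDerivAt_neg y)
    refine (((h.hasDerivAt_deformation t ht y).sub h1).const_mul σ).congr_deriv ?_
    ring
  refine ⟨?_, hloc.second_deriv_nonpos (.of_forall hd) hd2⟩
  have := hloc.hasDerivAt_eq_zero (hd y)
  rcases mul_eq_zero.1 this with h0 | h0
  · exact absurd h0 hσ
  · linarith

/-- With `β = 0` and `σ = ±1` this yields oddness. The linear term, invisible to second time
derivatives and to maxima in `y`, serves to bound the initial velocity in the planning problem. -/
theorem reflection_sum_le (h : IsEllipticMotion R T M a X q A V) (hT : 0 < T) (hM : 0 < M)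
    {σ β : ℝ} (hσ : σ ≠ 0) (hinit : ∀ y, σ * (X y 0 + X (-y) 0) ≤ 0)
    (hterm : ∀ y ∈ Icc 0 M, IsMaxOn (fun y => σ * (X y T + X (-y) T)) (Icc 0 M) y →
      0 < σ * (X y T + X (-y) T) + β * T → σ * (V y T + V (-y) T) + β ≤ 0) {t : ℝ}
    (ht : t ∈ Icc 0 T) (y : ℝ) : σ * (X y t + X (-y) t) + β * t ≤ 0 := by
  have hiff : ∀ s z, IsMaxOn (fun y => σ * (X y s + X (-y) s) + β * s) (Icc 0 M) z →
      IsMaxOn (fun y => σ * (X y s + X (-y) s)) (Icc 0 M) z := fun s z hz w hw => by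
    have h1 : σ * (X w s + X (-w) s) + β * s ≤ σ * (X z s + X (-z) s) + β * s := hz hw
    show σ * (X w s + X (-w) s) ≤ σ * (X z s + X (-z) s)
    linarith
  have key := nonpos_of_second_deriv_nonneg_at_max (isCompact_Icc (a := (0 : ℝ)) (b := M)) hT
    (W := fun y t => σ * (X y t + X (-y) t) + β * t)
    (W' := fun y t => σ * (V y t + V (-y) t) + β) ?_ ?_ ?_ ?_ ?_
  · obtain ⟨y', hy', hyy⟩ := Function.Periodic.exists_mem_Ico₀
      (f := fun y => σ * (X y t + X (-y) t)) (c := M) (fun y => by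
        have h1 := h.sub_period ht (-y)
        have h2 := h.add_period t ht y
        simp only [show -(y + M) = -y - M by ring, h1, h2]
        ring) hM y
    have := key y' (Ico_subset_Icc_self hy') t ht
    have hyy' : σ * (X y t + X (-y) t) = σ * (X y' t + X (-y') t) := hyy
    rw [hyy']
    exact this
  · have h1 : ContinuousOn (fun z : ℝ × ℝ => X z.1 z.2) (Icc 0 M ×ˢ Icc 0 T) :=
      h.continuousOn.mono (prod_mono_left (subset_univ _))
    have h2 : ContinuousOn (fun z : ℝ × ℝ => X (-z.1) z.2) (Icc 0 M ×ˢ Icc 0 T) :=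
      h.continuousOn.comp (f := fun z : ℝ × ℝ => (-z.1, z.2)) (by fun_prop)
        fun z hz => ⟨mem_univ _, hz.2⟩
    exact (continuousOn_const.mul (h1.add h2)).add (by fun_prop)
  · intro z _ s hs
    refine ((((h.hasDerivWithinAt_time s hs z).add
      (h.hasDerivWithinAt_time s hs (-z))).const_mul σ).add
      ((hasDerivWithinAt_id s _).const_mul β)).congr_deriv ?_
    ring
  · intro z _ s hs hmax _
    obtain ⟨h1, h2⟩ := h.reflection_at_max hM (Ioo_subset_Icc_self hs) hσ (hiff s z hmax)
    refine ⟨-(a (q z s) * (σ * (A z s + A (-z) s))), ?_, ?_⟩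
    · exact neg_nonneg.2 (mul_nonpos_of_nonneg_of_nonpos (h.nonneg s hs z) h2)
    · refine ((((h.hasDerivAt_velocity s hs z).add
        (h.hasDerivAt_velocity s hs (-z))).const_mul σ).add_const β).congr_deriv ?_
      -- Equal deformations at `z` and `-z`: the coefficient `a` factors out.
      rw [h1]
      ring
  · intro z _
    simpa using hinit z
  · intro z hz hmax hpos
    exact hterm z hz (hiff T z hmax) hpos

/-- At a positive maximum of `2 X(l) - X(l + s) - X(l - s)`, the three deformations agree. -/
theorem midpoint_at_max (h : IsEllipticMotion R T M a X q A V) (hM : 0 < M) {t : ℝ}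
    (ht : t ∈ Icc 0 T) (hodd : ∀ y, X (-y) t = -X y t) {l s : ℝ} (hl : l ∈ Icc 0 (M / 2))
    (hmax : IsMaxOn (fun p : ℝ × ℝ => 2 * X p.1 t - X (p.1 + p.2) t - X (p.1 - p.2) t)
      (Icc 0 (M / 2) ×ˢ Icc 0 M) (l, s))
    (hpos : 0 < 2 * X l t - X (l + s) t - X (l - s) t) :
    q (l + s) t = q l t ∧ q (l - s) t = q l t ∧ 2 * A l t - A (l + s) t - A (l - s) t ≤ 0 := by
  have hglob : ∀ l' ∈ Icc 0 (M / 2), ∀ s', 2 * X l' t - X (l' + s') t - X (l' - s') t ≤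
      2 * X l t - X (l + s) t - X (l - s) t := by
    intro l' hl' s'
    obtain ⟨z, hz, hzz⟩ := Function.Periodic.exists_mem_Ico₀
      (f := fun s => 2 * X l' t - X (l' + s) t - X (l' - s) t) (c := M) (fun y => by
        have h1 := h.sub_period ht (l' - y)
        have h2 := h.add_period t ht (l' + y)
        simp only [show l' - (y + M) = l' - y - M by ring, ← add_assoc, h1, h2]
        ring) hM s'
    have hzz' : 2 * X l' t - X (l' + s') t - X (l' - s') t =
      2 * X l' t - X (l' + z) t - X (l' - z) t := hzz
    rw [hzz']
    exact hmax (show (l', z) ∈ Icc 0 (M / 2) ×ˢ Icc 0 M from ⟨hl', Ico_subset_Icc_self hz⟩)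
  -- The second difference vanishes at `l = 0` by oddness, and at `l = M/2` by oddness and
  -- periodicity; a positive maximum is therefore interior in `l`.
  have hl0 : 0 < l := by
    refine lt_of_le_of_ne hl.1 fun h0 => ?_
    rw [← h0] at hpos
    have h1 := hodd 0
    have h2 := hodd s
    simp only [neg_zero, zero_add, zero_sub] at h1 h2 hpos
    linarith
  have hlM : l < M / 2 := by
    refine lt_of_le_of_ne hl.2 fun h0 => ?_
    rw [h0] at hpos
    have h1 := hodd (M / 2)
    have h2 := hodd (M / 2 + s)
    have h3 := h.sub_period ht (M / 2)
    have h4 := h.sub_period ht (M / 2 - s)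
    rw [show M / 2 - M = -(M / 2) by ring] at h3
    rw [show M / 2 - s - M = -(M / 2 + s) by ring] at h4
    linarith
  have hX := h.hasDerivAt_space t ht
  have hq := h.hasDerivAt_deformation t ht
  have hlocl : IsLocalMax (fun l => 2 * X l t - X (l + s) t - X (l - s) t) l := by
    filter_upwards [Icc_mem_nhds hl0 hlM] with l' hl' using hglob l' hl' s
  have hlocs : IsLocalMax (fun s => 2 * X l t - X (l + s) t - X (l - s) t) s :=
    .of_forall fun s' => hglob l hl s'
  have hdl : ∀ z, HasDerivAt (fun l => 2 * X l t - X (l + s) t - X (l - s) t)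
      (2 * q z t - q (z + s) t - q (z - s) t) z := fun z =>
    (((hX z).const_mul 2).sub ((hX (z + s)).comp_add_const z s)).sub
      ((hX (z - s)).comp_sub_const z s)
  have hdl2 : HasDerivAt (fun z => 2 * q z t - q (z + s) t - q (z - s) t)
      (2 * A l t - A (l + s) t - A (l - s) t) l :=
    (((hq l).const_mul 2).sub ((hq (l + s)).comp_add_const l s)).sub
      ((hq (l - s)).comp_sub_const l s)
  have hds : HasDerivAt (fun s => 2 * X l t - X (l + s) t - X (l - s) t)
      (-q (l + s) t + q (l - s) t) s := by
    refine ((((hX (l + s)).comp_const_add l s).const_sub (2 * X l t)).sub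
      ((hX (l - s)).comp_const_sub l s)).congr_deriv ?_
    ring
  -- The `l`-derivative gives `2 q(l) = q(l+s) + q(l-s)`, the `s`-derivative `q(l+s) = q(l-s)`.
  have e1 := hlocl.hasDerivAt_eq_zero (hdl l)
  have e2 := hlocs.hasDerivAt_eq_zero hds
  exact ⟨by linarith, by linarith, hlocl.second_deriv_nonpos (.of_forall hdl) hdl2⟩

/-- The motion remains convex on half a period if it is convex at the end points of the time
interval; the terminal condition may be replaced by `V = b(q) X_yy` with `b ≥ 0`. -/
theorem midpoint_le (h : IsEllipticMotion R T M a X q A V) (hT : 0 < T) (hM : 0 < M)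
    (hodd : ∀ t ∈ Icc 0 T, ∀ y, X (-y) t = -X y t)
    (hinit : ∀ l ∈ Icc 0 (M / 2), ∀ s ∈ Icc 0 M, 2 * X l 0 - X (l + s) 0 - X (l - s) 0 ≤ 0)
    (hterm : (∀ l ∈ Icc 0 (M / 2), ∀ s ∈ Icc 0 M, 2 * X l T - X (l + s) T - X (l - s) T ≤ 0) ∨
      ∃ b : ℝ → ℝ, (∀ y, 0 ≤ b (q y T)) ∧ ∀ y, V y T = b (q y T) * A y T)
    {t : ℝ} (ht : t ∈ Icc 0 T) {l s : ℝ} (hl : l ∈ Icc 0 (M / 2)) (hs : s ∈ Icc 0 M) :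
    2 * X l t ≤ X (l + s) t + X (l - s) t := by
  have key := nonpos_of_second_deriv_nonneg_at_max
    ((isCompact_Icc (a := (0 : ℝ)) (b := M / 2)).prod (isCompact_Icc (a := (0 : ℝ)) (b := M))) hT
    (W := fun p t => 2 * X p.1 t - X (p.1 + p.2) t - X (p.1 - p.2) t)
    (W' := fun p t => 2 * V p.1 t - V (p.1 + p.2) t - V (p.1 - p.2) t) ?_ ?_ ?_ ?_ ?_
  · have := key (l, s) ⟨hl, hs⟩ t ht
    simp only at this
    linarith
  · have hc : ∀ g : (ℝ × ℝ) × ℝ → ℝ, Continuous g → ContinuousOn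
        (fun z : (ℝ × ℝ) × ℝ => X (g z) z.2) ((Icc 0 (M / 2) ×ˢ Icc 0 M) ×ˢ Icc 0 T) :=
      fun g hg => h.continuousOn.comp (f := fun z : (ℝ × ℝ) × ℝ => (g z, z.2)) (by fun_prop)
        fun z hz => ⟨mem_univ _, hz.2⟩
    exact ((continuousOn_const.mul (hc (fun z => z.1.1) (by fun_prop))).sub
      (hc (fun z => z.1.1 + z.1.2) (by fun_prop))).sub
      (hc (fun z => z.1.1 - z.1.2) (by fun_prop))
  · rintro ⟨l, s⟩ _ t ht
    exact (((h.hasDerivWithinAt_time t ht l).const_mul 2).sub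
      (h.hasDerivWithinAt_time t ht (l + s))).sub (h.hasDerivWithinAt_time t ht (l - s))
  · rintro ⟨l, s⟩ ⟨hl, _⟩ t ht hmax hpos
    have htc := Ioo_subset_Icc_self ht
    obtain ⟨h1, h2, h3⟩ := h.midpoint_at_max hM htc (hodd t htc) hl hmax hpos
    refine ⟨-(a (q l t) * (2 * A l t - A (l + s) t - A (l - s) t)), ?_, ?_⟩
    · exact neg_nonneg.2 (mul_nonpos_of_nonneg_of_nonpos (h.nonneg t ht l) h3)
    · refine ((((h.hasDerivAt_velocity t ht l).const_mul 2).sub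
        (h.hasDerivAt_velocity t ht (l + s))).sub
        (h.hasDerivAt_velocity t ht (l - s))).congr_deriv ?_
      rw [h1, h2]
      ring
  · rintro ⟨l, s⟩ ⟨hl, hs⟩
    exact hinit l hl s hs
  · rintro ⟨l, s⟩ ⟨hl, hs⟩ hmax hpos
    rcases hterm with hle | ⟨b, hb, hV⟩
    · exact absurd hpos (not_lt.2 (hle l hl s hs))
    · have hTc := right_mem_Icc.2 hT.le
      obtain ⟨h1, h2, h3⟩ := h.midpoint_at_max hM hTc (hodd T hTc) hl hmax hpos
      -- With equal deformations the factor `b` is common, and the second-order condition gives the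
      -- sign.
      simp only [hV, h1, h2]
      have := mul_nonpos_of_nonneg_of_nonpos (hb l) h3
      linarith

/-- Midpoint convexity gives a nonnegative second derivative. -/
theorem second_deriv_nonneg (h : IsEllipticMotion R T M a X q A V) (hM : 0 < M) {t l : ℝ}
    (ht : t ∈ Icc 0 T) (hmid : ∀ s ∈ Icc 0 M, 2 * X l t ≤ X (l + s) t + X (l - s) t) :
    0 ≤ A l t := by
  have hX := h.hasDerivAt_space t ht
  have hq := h.hasDerivAt_deformation t ht
  have hds : ∀ s, HasDerivAt (fun s => 2 * X l t - X (l + s) t - X (l - s) t)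
      (-q (l + s) t + q (l - s) t) s := by
    intro s
    refine ((((hX (l + s)).comp_const_add l s).const_sub (2 * X l t)).sub
      ((hX (l - s)).comp_const_sub l s)).congr_deriv ?_
    ring
  have hds2 : HasDerivAt (fun s => -q (l + s) t + q (l - s) t) (-A l t + -A l t) 0 := by
    have h1 : HasDerivAt (fun y => q y t) (A l t) (l + 0) := by rw [add_zero]; exact hq l
    have h2 : HasDerivAt (fun y => q y t) (A l t) (l - 0) := by rw [sub_zero]; exact hq l
    exact (h1.comp_const_add l 0).neg.add (h2.comp_const_sub l 0)
  -- The value at `s = 0` is zero, and the function is even in `s`; its second derivative there is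
  -- `-2 A l t`.
  have hloc : IsLocalMax (fun s => 2 * X l t - X (l + s) t - X (l - s) t) 0 := by
    filter_upwards [Ioo_mem_nhds (neg_lt_zero.2 hM) hM] with s hs
    simp only [add_zero, sub_zero]
    rcases le_total 0 s with h0 | h0
    · have := hmid s ⟨h0, hs.2.le⟩
      linarith
    · have := hmid (-s) ⟨by linarith, by linarith [hs.1]⟩
      rw [sub_neg_eq_add, ← sub_eq_add_neg] at this
      linarith
  have := hloc.second_deriv_nonpos (.of_forall hds) hds2
  linarith

end IsEllipticMotion

/-! ### From the density to the motion and back. -/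

theorem deriv_nonneg_of_monotoneOn_Ioi {g : ℝ → ℝ} (hg : MonotoneOn g (Ioi 0)) {r : ℝ}
    (hr : 0 < r) : 0 ≤ deriv g r := by
  rw [← derivWithin_of_isOpen isOpen_Ioi hr]
  exact hg.derivWithin_nonneg

/-- The second derivative of the position with respect to the mass coordinate. -/
noncomputable def positionSecond (u m : ℝ → ℝ → ℝ) (y t : ℝ) : ℝ :=
  -spaceDeriv m (position u m y t) t / m (position u m y t) t ^ 3

section Assembly

variable {R T : ℝ} {f g m₀ mT : ℝ → ℝ} {u m : ℝ → ℝ → ℝ}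

theorem IsPositiveClassicalSolution.isEllipticMotion
    (h : IsPositiveClassicalSolution R T f u m) (hR : 0 < R) (hT : 0 < T)
    (hf : ContDiffOn ℝ 1 f (Ioi 0)) (hf_mono : MonotoneOn f (Ioi 0)) :
    IsEllipticMotion R T (massCoord u m R 0) (fun r => deriv f r⁻¹ * r⁻¹ ^ 3)
      (position u m) (fun y t => (m (position u m y t) t)⁻¹) (positionSecond u m)
      (fun y t => -spaceDeriv u (position u m y t) t) where
  continuousOn := h.continuousOn_position hR hT
  hasDerivAt_space t ht y := h.hasDerivAt_position hR hT ht y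
  hasDerivAt_deformation t ht y := by
    have hm := (h.pos (position u m y t) t ht).ne'
    have h1 : HasDerivAt (fun z => m (position u m z t) t)
        (spaceDeriv m (position u m y t) t * (m (position u m y t) t)⁻¹) y :=
      (hasDerivAt_spaceDeriv h.contDiffOn_m (position u m y t) ht).comp y
        (h.hasDerivAt_position hR hT ht y)
    refine (h1.fun_inv hm).congr_deriv ?_
    rw [positionSecond]
    field_simp
  hasDerivWithinAt_time t ht y := h.hasDerivWithinAt_position_time hR hT y ht
  hasDerivAt_velocity t ht y := by
    have hm := (h.pos (position u m y t) t (Ioo_subset_Icc_self ht)).ne'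
    refine (h.hasDerivAt_velocity hf ht
      (h.hasDerivAt_position_time_of_mem_Ioo hR hT y ht)).congr_deriv ?_
    simp only [positionSecond, inv_inv]
    field_simp
  nonneg t ht y := by
    have hm := h.pos (position u m y t) t (Ioo_subset_Icc_self ht)
    simp only [inv_inv]
    exact mul_nonneg (deriv_nonneg_of_monotoneOn_Ioi hf_mono hm) (by positivity)
  add_period t ht y := h.position_add_period hR hT ht y

theorem IsPositiveClassicalSolution.massCoord_neg (h : IsPositiveClassicalSolution R T f u m)
    {t : ℝ} (ht : t ∈ Icc 0 T) (heven : ∀ x, m (-x) t = m x t) (x : ℝ) :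
    massCoord u m (-x) t = 2 * massCoord u m 0 t - massCoord u m x t := by
  have h1 : ∀ y, HasDerivAt (fun x => massCoord u m x t + massCoord u m (-x) t) 0 y := by
    intro y
    have := (h.hasDerivAt_massCoord y ht).add
      ((h.hasDerivAt_massCoord (-y) ht).comp y (hasDerivAt_neg y))
    refine this.congr_deriv ?_
    rw [heven]
    ring
  have h2 := eq_of_hasDerivAt_zero h1 x 0
  simp only [neg_zero] at h2
  linarith

/-- Labels count mass from the origin at time `0`; the accumulated flux `massCoord u m 0 t` is what
separates evenness of `m` from oddness of the position. -/
theorem IsPositiveClassicalSolution.position_neg (h : IsPositiveClassicalSolution R T f u m)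
    (hR : 0 < R) (hT : 0 < T) {t : ℝ} (ht : t ∈ Icc 0 T) (heven : ∀ x, m (-x) t = m x t)
    (y : ℝ) : position u m (-y) t = -position u m (y + 2 * massCoord u m 0 t) t :=
  h.position_eq ht (by
    rw [h.massCoord_neg ht heven, h.massCoord_position hR hT ht]
    ring)

theorem IsPositiveClassicalSolution.position_zero_and_half
    (h : IsPositiveClassicalSolution R T f u m) (hR : 0 < R) (hT : 0 < T) {t : ℝ}
    (ht : t ∈ Icc 0 T) (hodd : ∀ y, position u m (-y) t = -position u m y t) :
    position u m 0 t = 0 ∧ position u m (massCoord u m R 0 / 2) t = R / 2 := by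
  have h0 := hodd 0
  rw [neg_zero] at h0
  have h1 := h.position_add_period hR hT ht (-(massCoord u m R 0 / 2))
  rw [hodd, show -(massCoord u m R 0 / 2) + massCoord u m R 0 = massCoord u m R 0 / 2 by ring]
    at h1
  exact ⟨by linarith, by linarith⟩

/-- Oddness and periodicity pin the particles `0` and `M/2` at `0` and `R/2`, and particles keep
their order. -/
theorem IsPositiveClassicalSolution.position_mem_iff
    (h : IsPositiveClassicalSolution R T f u m) (hR : 0 < R) (hT : 0 < T) {t : ℝ}
    (ht : t ∈ Icc 0 T) (hodd : ∀ y, position u m (-y) t = -position u m y t) (y : ℝ) :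
    position u m y t ∈ Icc 0 (R / 2) ↔ y ∈ Icc 0 (massCoord u m R 0 / 2) := by
  obtain ⟨h0, h1⟩ := h.position_zero_and_half hR hT ht hodd
  have hmono := h.strictMono_position hR hT ht
  have h2 := hmono.le_iff_le (a := 0) (b := y)
  have h3 := hmono.le_iff_le (a := y) (b := massCoord u m R 0 / 2)
  simp only [h0, h1] at h2 h3
  simp only [mem_Icc, h2, h3]

theorem IsPositiveClassicalSolution.massCoord_mem
    (h : IsPositiveClassicalSolution R T f u m) (hR : 0 < R) (hT : 0 < T) {t : ℝ}
    (ht : t ∈ Icc 0 T) (hodd : ∀ y, position u m (-y) t = -position u m y t) {x : ℝ}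
    (hx : x ∈ Icc 0 (R / 2)) : massCoord u m x t ∈ Icc 0 (massCoord u m R 0 / 2) := by
  rwa [← h.position_mem_iff hR hT ht hodd, h.position_massCoord ht]

theorem IsPositiveClassicalSolution.midpoint_le_of_isEvenDecreasing
    (h : IsPositiveClassicalSolution R T f u m) (hR : 0 < R) (hT : 0 < T) {t : ℝ}
    (ht : t ∈ Icc 0 T) (hodd : ∀ y, position u m (-y) t = -position u m y t)
    (hm : IsEvenDecreasing R fun x => m x t) {l s : ℝ}
    (hl : l ∈ Icc 0 (massCoord u m R 0 / 2)) (hs : s ∈ Icc 0 (massCoord u m R 0)) :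
    2 * position u m l t - position u m (l + s) t - position u m (l - s) t ≤ 0 := by
  set M := massCoord u m R 0 with hMdef
  have hM : 0 < M := h.period_pos hR hT
  set X : ℝ → ℝ := fun y => position u m y t with hXdef
  set μ : ℝ → ℝ := fun y => m (X y) t with hμ
  have hper : ∀ y, X (y + M) = X y + R := h.position_add_period hR hT ht
  have hμper : ∀ y, μ (y + M) = μ y := fun y => by
    simp only [hμ, hper]
    exact h.periodic_m t ht (X y)
  have hμeven : ∀ y, μ (-y) = μ y := fun y => by
    have : X (-y) = -X y := hodd y
    simp only [hμ, this]
    exact hm.even (X y)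
  have hμanti : ∀ y ∈ Icc 0 (M / 2), ∀ z ∈ Icc 0 (M / 2), y ≤ z → μ z ≤ μ y :=
    fun y hy z hz hyz =>
      hm.antitoneOn ((h.position_mem_iff hR hT ht hodd y).2 hy)
        ((h.position_mem_iff hR hT ht hodd z).2 hz) ((h.strictMono_position hR hT ht).monotone hyz)
  -- Fold both points into `[0, M/2]` by the reflections about `0` and `M/2`: the image of `l + r`
  -- lies farther from `0`. Since `X_y = 1/μ`, this makes `X(l+r) + X(l-r)` nondecreasing in `r`.
  have hcompare : ∀ r ∈ Icc 0 (M / 2), μ (l + r) ≤ μ (l - r) := by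
    intro r hr
    have habs : μ (l - r) = μ |l - r| := by
      rcases abs_choice (l - r) with h1 | h1 <;> rw [h1]
      exact (hμeven _).symm
    have hle : |l - r| ≤ M / 2 :=
      abs_le.2 ⟨by linarith [hl.1, hr.2], by linarith [hl.2, hr.1]⟩
    have hle' : |l - r| ≤ l + r := abs_le.2 ⟨by linarith [hl.1], by linarith [hr.1]⟩
    rw [habs]
    rcases le_total (l + r) (M / 2) with hc | hc
    · exact hμanti _ ⟨abs_nonneg _, hle⟩ _ ⟨add_nonneg hl.1 hr.1, hc⟩ hle'
    · have h1 : μ (l + r) = μ (M - (l + r)) := by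
        rw [← hμeven, ← hμper (-(l + r))]
        congr 1
        ring
      rw [h1]
      refine hμanti _ ⟨abs_nonneg _, hle⟩ _ ⟨by linarith [hl.2, hr.2], by linarith⟩ ?_
      exact abs_le.2 ⟨by linarith [hl.2, hr.2], by linarith [hl.2, hr.2]⟩
  have hX : ∀ y, HasDerivAt X (μ y)⁻¹ y := h.hasDerivAt_position hR hT ht
  have hd : ∀ r, HasDerivAt (fun r => X (l + r) + X (l - r)) ((μ (l + r))⁻¹ + -(μ (l - r))⁻¹) r :=
    fun r => ((hX (l + r)).comp_const_add l r).add ((hX (l - r)).comp_const_sub l r)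
  have hmono : MonotoneOn (fun r => X (l + r) + X (l - r)) (Icc 0 (M / 2)) := by
    refine monotoneOn_of_hasDerivWithinAt_nonneg (convex_Icc _ _)
      (fun r _ => (hd r).continuousAt.continuousWithinAt)
      (fun r _ => (hd r).hasDerivWithinAt) fun r hr => ?_
    have := inv_anti₀ (h.pos (X (l + r)) t ht) (hcompare r (interior_subset hr))
    linarith
  have hhalf : ∀ r ∈ Icc 0 (M / 2), 2 * X l ≤ X (l + r) + X (l - r) := by
    intro r hr
    have := hmono (left_mem_Icc.2 (by linarith)) hr hr.1
    simp only [add_zero, sub_zero] at this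
    linarith
  show 2 * X l - X (l + s) - X (l - s) ≤ 0
  rcases le_total s (M / 2) with hc | hc
  · linarith [hhalf s ⟨hs.1, hc⟩]
  · have h1 := hhalf (M - s) ⟨by linarith [hs.2], by linarith⟩
    have h2 := hper (l - s)
    have h3 := hper (l - (M - s))
    rw [show l - s + M = l + (M - s) by ring] at h2
    rw [show l - (M - s) + M = l + s by ring] at h3
    linarith

/-- `X_yy = -m_x/m³`, so the sign of `m_x` is read off from the convexity of `X` on the half period.
-/
theorem IsPositiveClassicalSolution.spaceDeriv_m_nonpos
    (h : IsPositiveClassicalSolution R T f u m) (hR : 0 < R) (hT : 0 < T)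
    (hf : ContDiffOn ℝ 1 f (Ioi 0)) (hf_mono : MonotoneOn f (Ioi 0))
    (hodd : ∀ t ∈ Icc 0 T, ∀ y, position u m (-y) t = -position u m y t)
    (hinit : IsEvenDecreasing R fun x => m x 0)
    (hterm : (IsEvenDecreasing R fun x => m x T) ∨
      ∃ b : ℝ → ℝ, (∀ y, 0 ≤ b (m (position u m y T) T)⁻¹) ∧
        ∀ y, -spaceDeriv u (position u m y T) T =
          b (m (position u m y T) T)⁻¹ * positionSecond u m y T)
    {t x : ℝ} (ht : t ∈ Icc 0 T) (hx : x ∈ Icc 0 (R / 2)) : spaceDeriv m x t ≤ 0 := by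
  have h0 := left_mem_Icc.2 hT.le
  have h1 := right_mem_Icc.2 hT.le
  have hell := h.isEllipticMotion hR hT hf hf_mono
  have hM := h.period_pos hR hT
  have hl := h.massCoord_mem hR hT ht (hodd t ht) hx
  have hA := hell.second_deriv_nonneg hM ht fun s hs =>
    hell.midpoint_le hT hM hodd
      (fun l hl s hs => h.midpoint_le_of_isEvenDecreasing hR hT h0 (hodd 0 h0) hinit hl hs)
      (hterm.imp_left fun hmT l hl s hs =>
        h.midpoint_le_of_isEvenDecreasing hR hT h1 (hodd T h1) hmT hl hs) ht hl hs
  rw [positionSecond, h.position_massCoord ht] at hA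
  by_contra! hc
  exact absurd hA (not_le.2 (div_neg_of_neg_of_pos (neg_neg_of_pos hc)
    (pow_pos (h.pos x t ht) 3)))

theorem IsPositiveClassicalSolution.isEvenDecreasing
    (h : IsPositiveClassicalSolution R T f u m) (hR : 0 < R) (hT : 0 < T) {t : ℝ}
    (ht : t ∈ Icc 0 T) (hodd : ∀ y, position u m (-y) t = -position u m y t)
    (hmx : ∀ x ∈ Icc 0 (R / 2), spaceDeriv m x t ≤ 0) :
    IsEvenDecreasing R fun x => m x t := by
  have heven : ∀ x, m (-x) t = m x t := by
    intro x
    have h1 := h.hasDerivAt_position hR hT ht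
    set y := massCoord u m x t with hy
    have hx : position u m y t = x := h.position_massCoord ht x
    -- Differentiating the oddness relation in the label compares `1/m` at `x` and `-x`.
    have h2 : HasDerivAt (fun z => position u m (-z) t) ((m (position u m (-y) t) t)⁻¹ * -1) y :=
      (h1 (-y)).comp y (hasDerivAt_neg y)
    simp only [hodd] at h2
    have h3 := h2.unique (h1 y).neg
    rw [hx, mul_neg_one, neg_inj, inv_inj] at h3
    exact h3
  have hanti : AntitoneOn (fun x => m x t) (Icc 0 (R / 2)) :=
    antitoneOn_of_hasDerivWithinAt_nonpos (convex_Icc _ _)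
      (continuous_slice h.contDiffOn_m.continuousOn ht).continuousOn
      (fun x _ => (hasDerivAt_spaceDeriv h.contDiffOn_m x ht).hasDerivWithinAt)
      fun x hx => hmx x (interior_subset hx)
  refine ⟨heven, hanti, fun x hx y hy hxy => ?_⟩
  have := hanti (a := -y) (b := -x) ⟨by linarith [hy.2], by linarith [hy.1]⟩
    ⟨by linarith [hx.2], by linarith [hx.1]⟩ (by linarith)
  simpa only [heven] using this

/-- The particle stays in `[0, R/2]`, where its acceleration `f'(m) m_x` is nonpositive. -/
theorem IsPositiveClassicalSolution.antitoneOn_velocity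
    (h : IsPositiveClassicalSolution R T f u m) (hR : 0 < R) (hT : 0 < T)
    (hf : ContDiffOn ℝ 1 f (Ioi 0)) (hf_mono : MonotoneOn f (Ioi 0))
    (hodd : ∀ t ∈ Icc 0 T, ∀ y, position u m (-y) t = -position u m y t)
    (hmx : ∀ t ∈ Icc 0 T, ∀ x ∈ Icc 0 (R / 2), spaceDeriv m x t ≤ 0) {y : ℝ}
    (hy : y ∈ Icc 0 (massCoord u m R 0 / 2)) :
    AntitoneOn (fun t => -spaceDeriv u (position u m y t) t) (Icc 0 T) := by
  refine antitoneOn_of_hasDerivWithinAt_nonpos (convex_Icc _ _)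
    (h.continuousOn_velocity hT
      (continuousOn_time (w := position u m) (h.continuousOn_position hR hT) y))
    (f' := fun t => deriv f (m (position u m y t) t) * spaceDeriv m (position u m y t) t)
    (fun t ht => ?_) fun t ht => ?_
  · rw [interior_Icc] at ht
    exact (h.hasDerivAt_velocity hf ht
      (h.hasDerivAt_position_time_of_mem_Ioo hR hT y ht)).hasDerivWithinAt
  · have htc := interior_subset ht
    exact mul_nonpos_of_nonneg_of_nonpos
      (deriv_nonneg_of_monotoneOn_Ioi hf_mono (h.pos _ t htc))
      (hmx t htc _ ((h.position_mem_iff hR hT htc (hodd t htc) y).2 hy))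

theorem IsPositiveClassicalSolution.concaveOn_trajectory
    (h : IsPositiveClassicalSolution R T f u m) (hT : 0 < T) {x : ℝ}
    {γ : ℝ → ℝ} (hγ : IsOptimalTrajectory T u x γ)
    (hanti : AntitoneOn (fun t => -spaceDeriv u (position u m (massCoord u m x 0) t) t)
      (Icc 0 T)) : ConcaveOn ℝ (Icc 0 T) γ := by
  have hd : ∀ t ∈ Ioo 0 T,
      HasDerivAt γ (-spaceDeriv u (position u m (massCoord u m x 0) t) t) t := by
    intro t ht
    rw [← h.eq_position_of_isOptimalTrajectory hT hγ (Ioo_subset_Icc_self ht)]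
    exact (hγ.flow t (Ioo_subset_Icc_self ht)).hasDerivAt (Icc_mem_nhds ht.1 ht.2)
  refine AntitoneOn.concaveOn_of_deriv (convex_Icc _ _)
    (fun t ht => (hγ.flow t ht).continuousWithinAt) ?_ ?_ <;> rw [interior_Icc]
  · exact fun t ht => (hd t ht).differentiableAt.differentiableWithinAt
  · intro s hs t ht hst
    rw [(hd s hs).deriv, (hd t ht).deriv]
    exact hanti (Ioo_subset_Icc_self hs) (Ioo_subset_Icc_self ht) hst

/-! ### Terminal conditions and oddness of the motion. -/

theorem SolvesTerminalCost.velocity_terminal (h : SolvesTerminalCost R T f g m₀ u m)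
    (hT : 0 < T) (hg : ContDiffOn ℝ 1 g (Ioi 0)) (x : ℝ) :
    spaceDeriv u x T = deriv g (m x T) * spaceDeriv m x T := by
  have hTc := right_mem_Icc.2 hT.le
  have h1 : HasDerivAt (fun y => g (m y T)) (deriv g (m x T) * spaceDeriv m x T) x :=
    HasDerivAt.comp x ((hg.contDiffAt (Ioi_mem_nhds (h.pos x T hTc))).differentiableAt
      one_ne_zero).hasDerivAt (hasDerivAt_spaceDeriv h.contDiffOn_m x hTc)
  rw [← h1.deriv, spaceDeriv]
  congr 1
  exact funext h.terminal

theorem SolvesTerminalCost.velocity_terminal_eq (h : SolvesTerminalCost R T f g m₀ u m)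
    (hT : 0 < T) (hg : ContDiffOn ℝ 1 g (Ioi 0)) (y : ℝ) :
    -spaceDeriv u (position u m y T) T =
      (fun r : ℝ => deriv g r⁻¹ * r⁻¹ ^ 3) (m (position u m y T) T)⁻¹ *
        positionSecond u m y T := by
  have hm := (h.pos (position u m y T) T (right_mem_Icc.2 hT.le)).ne'
  rw [h.velocity_terminal hT hg]
  simp only [positionSecond, inv_inv]
  field_simp

theorem IsPositiveClassicalSolution.position_neg_zero
    (h : IsPositiveClassicalSolution R T f u m) (hR : 0 < R) (hT : 0 < T)
    (heven : ∀ x, m (-x) 0 = m x 0) (y : ℝ) : position u m (-y) 0 = -position u m y 0 := by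
  rw [h.position_neg hR hT (left_mem_Icc.2 hT.le) heven]
  simp [massCoord]

theorem SolvesTerminalCost.position_odd (h : SolvesTerminalCost R T f g m₀ u m)
    (hR : 0 < R) (hT : 0 < T) (hf : ContDiffOn ℝ 1 f (Ioi 0)) (hg : ContDiffOn ℝ 1 g (Ioi 0))
    (hf_mono : MonotoneOn f (Ioi 0)) (hg_mono : MonotoneOn g (Ioi 0))
    (heven : ∀ x, m (-x) 0 = m x 0) {t : ℝ} (ht : t ∈ Icc 0 T) (y : ℝ) :
    position u m (-y) t = -position u m y t := by
  have hs := h.toIsPositiveClassicalSolution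
  have hell := hs.isEllipticMotion hR hT hf hf_mono
  have hM := hs.period_pos hR hT
  have hTc := right_mem_Icc.2 hT.le
  have key : ∀ σ : ℝ, σ ≠ 0 → σ * (position u m y t + position u m (-y) t) ≤ 0 := by
    intro σ hσ
    have := hell.reflection_sum_le hT hM (β := 0) hσ
      (fun z => by rw [hs.position_neg_zero hR hT heven]; simp)
      (fun z _ hz _ => by
        obtain ⟨h1, h2⟩ := hell.reflection_at_max hM hTc hσ hz
        rw [h.velocity_terminal_eq hT hg, h.velocity_terminal_eq hT hg, h1]
        have hm := hs.pos (position u m z T) T hTc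
        have h3 : 0 ≤ deriv g (m (position u m z T) T) * m (position u m z T) T ^ 3 :=
          mul_nonneg (deriv_nonneg_of_monotoneOn_Ioi hg_mono hm) (by positivity)
        have h4 := mul_nonpos_of_nonneg_of_nonpos h3 h2
        simp only [inv_inv]
        linarith) ht y
    simpa using this
  have h1 := key 1 one_ne_zero
  have h2 := key (-1) (by norm_num)
  linarith

/-- The periodicity of `u` prevents the planning problem from transporting a net flux. -/
theorem SolvesPlanning.massCoord_zero_terminal (h : SolvesPlanning R T f m₀ mT u m)
    (hR : 0 < R) (hT : 0 < T) (hf : ContDiffOn ℝ 1 f (Ioi 0)) (hf_mono : MonotoneOn f (Ioi 0))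
    (heven : ∀ x, m (-x) 0 = m x 0) (hevenT : ∀ x, m (-x) T = m x T) :
    massCoord u m 0 T = 0 := by
  by_contra hc
  have hs := h.toIsPositiveClassicalSolution
  have hell := hs.isEllipticMotion hR hT hf hf_mono
  have hM := hs.period_pos hR hT
  have h0 := left_mem_Icc.2 hT.le
  have hTc := right_mem_Icc.2 hT.le
  -- With `c` the net flux, `X(y) + X(-y) = X(y) - X(y + 2c)` at time `T`, whose sign is opposite to
  -- that of `c` for every `y`.
  obtain ⟨σ, hσ, hsum⟩ : ∃ σ : ℝ, σ ≠ 0 ∧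
      ∀ y, σ * (position u m y T + position u m (-y) T) < 0 := by
    have hmono := hs.strictMono_position hR hT hTc
    rcases lt_or_gt_of_ne hc with hc | hc
    · refine ⟨-1, by norm_num, fun y => ?_⟩
      rw [hs.position_neg hR hT hTc hevenT]
      have : position u m (y + 2 * massCoord u m 0 T) T < position u m y T :=
        hmono (by linarith)
      linarith
    · refine ⟨1, one_ne_zero, fun y => ?_⟩
      rw [hs.position_neg hR hT hTc hevenT]
      have : position u m y T < position u m (y + 2 * massCoord u m 0 T) T :=
        hmono (by linarith)
      linarith
  have hcX := continuous_slice (w := position u m) (hs.continuousOn_position hR hT) hTc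
  have hcS : Continuous fun y => σ * (position u m y T + position u m (-y) T) :=
    continuous_const.mul (hcX.add (hcX.comp continuous_neg))
  obtain ⟨y₁, hy₁, hmax⟩ := isCompact_Icc.exists_isMaxOn (nonempty_Icc.2 hM.le) hcS.continuousOn
  -- The slope `d/T` is the largest for which the sum plus `(d/T) t` is still nonpositive at `T`;
  -- the terminal hypothesis of the comparison is then vacuous.
  set d := -(σ * (position u m y₁ T + position u m (-y₁) T)) with hd
  have hdpos : 0 < d := neg_pos.2 (hsum y₁)
  have hdT : d / T * T = d := div_mul_cancel₀ d hT.ne'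
  have hle : ∀ y, ∀ t ∈ Icc 0 T,
      σ * (position u m y t + position u m (-y) t) + d / T * t ≤ 0 := fun y t ht =>
    hell.reflection_sum_le hT hM hσ
      (fun z => by rw [hs.position_neg_zero hR hT heven]; simp)
      (fun z hzm hz hpos => by
        have : σ * (position u m y₁ T + position u m (-y₁) T) ≤
          σ * (position u m z T + position u m (-z) T) := hz hy₁
        have h2 : σ * (position u m z T + position u m (-z) T) ≤
          σ * (position u m y₁ T + position u m (-y₁) T) := hmax hzm
        linarith) ht y
  -- The reflected sum vanishes at time `0`, so the linear bound passes to its initial time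
  -- derivative.
  have hvel : ∀ x, σ * (spaceDeriv u x 0 + spaceDeriv u (-x) 0) > 0 := by
    intro x
    set y := massCoord u m x 0 with hy
    have hx : position u m y 0 = x := hs.position_massCoord h0 x
    have hx' : position u m (-y) 0 = -x := by rw [hs.position_neg_zero hR hT heven, hx]
    have h1 := ((hs.hasDerivWithinAt_position_time hR hT y h0).add
      (hs.hasDerivWithinAt_position_time hR hT (-y) h0)).const_mul (-σ)
    have h2 := HasDerivWithinAt.le_left_of_mul_le (e := d / T) hT h1
      (by simp [hx, hx']) (fun t ht => by
        have := hle y t ht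
        simp only [Pi.add_apply]
        linarith)
    rw [hx, hx'] at h2
    have : 0 < d / T := by positivity
    linarith
  have hu : ∀ x, HasDerivAt (fun x => u x 0) (spaceDeriv u x 0) x := fun x =>
    hasDerivAt_spaceDeriv (hs.contDiffOn_u.of_le (by norm_num)) x h0
  have hψ : ∀ x, HasDerivAt (fun x => σ * (u x 0 - u (-x) 0))
      (σ * (spaceDeriv u x 0 + spaceDeriv u (-x) 0)) x := by
    intro x
    refine (((hu x).sub ((hu (-x)).comp x (hasDerivAt_neg x))).const_mul σ).congr_deriv ?_
    ring
  -- Periodicity of `u` makes this function vanish at both `0` and `R`, a contradiction.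
  have hmono : StrictMono fun x => σ * (u x 0 - u (-x) 0) :=
    strictMono_of_deriv_pos fun x => by
      rw [(hψ x).deriv]
      exact hvel x
  have h1 := hmono hR
  have h2 : u (0 + R) 0 = u 0 0 := hs.periodic_u 0 h0 0
  have h3 : u (-R + R) 0 = u (-R) 0 := hs.periodic_u 0 h0 (-R)
  rw [zero_add] at h2
  rw [neg_add_cancel] at h3
  simp only [neg_zero, h2, ← h3, sub_self, mul_zero, lt_irrefl] at h1

theorem SolvesPlanning.position_odd (h : SolvesPlanning R T f m₀ mT u m)
    (hR : 0 < R) (hT : 0 < T) (hf : ContDiffOn ℝ 1 f (Ioi 0)) (hf_mono : MonotoneOn f (Ioi 0))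
    (heven : ∀ x, m (-x) 0 = m x 0) (hevenT : ∀ x, m (-x) T = m x T) {t : ℝ}
    (ht : t ∈ Icc 0 T) (y : ℝ) : position u m (-y) t = -position u m y t := by
  have hs := h.toIsPositiveClassicalSolution
  have hell := hs.isEllipticMotion hR hT hf hf_mono
  have hoddT : ∀ z, position u m (-z) T = -position u m z T := fun z => by
    rw [hs.position_neg hR hT (right_mem_Icc.2 hT.le) hevenT,
      h.massCoord_zero_terminal hR hT hf hf_mono heven hevenT]
    simp
  have key : ∀ σ : ℝ, σ ≠ 0 → σ * (position u m y t + position u m (-y) t) ≤ 0 := by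
    intro σ hσ
    have := hell.reflection_sum_le hT (hs.period_pos hR hT) (β := 0) hσ
      (fun z => by rw [hs.position_neg_zero hR hT heven]; simp)
      (fun z _ _ hpos => by
        rw [hoddT] at hpos
        simp at hpos) ht y
    simpa using this
  have h1 := key 1 one_ne_zero
  have h2 := key (-1) (by norm_num)
  linarith

end Assembly

/-! ### Conclusion for the two boundary conditions. -/

theorem lemma5p7 (R T : ℝ) (hR : 0 < R) (hT : 0 < T) (f g : ℝ → ℝ)
    (hf : ContDiffOn ℝ 1 f (Ioi 0)) (hg : ContDiffOn ℝ 1 g (Ioi 0))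
    (hf_mono : MonotoneOn f (Ioi 0)) (hg_mono : MonotoneOn g (Ioi 0))
    (m₀ mT : ℝ → ℝ) (u m : ℝ → ℝ → ℝ) :
    (SolvesTerminalCost R T f g m₀ u m → IsEvenDecreasing R m₀ →
      (∀ t ∈ Icc 0 T, IsEvenDecreasing R (fun x => m x t)) ∧
      (∀ x ∈ Icc 0 (R / 2), ∀ γ : ℝ → ℝ, IsOptimalTrajectory T u x γ →
        ConcaveOn ℝ (Icc 0 T) γ ∧ MonotoneOn γ (Icc 0 T)) ∧
      (∀ x ∈ Icc 0 (R / 2), ∀ t ∈ Icc 0 T, deriv (fun y => u y t) x ≤ 0)) ∧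
    (SolvesPlanning R T f m₀ mT u m → IsEvenDecreasing R m₀ → IsEvenDecreasing R mT →
      (∀ t ∈ Icc 0 T, IsEvenDecreasing R (fun x => m x t)) ∧
      (∀ x ∈ Icc 0 (R / 2), ∀ γ : ℝ → ℝ, IsOptimalTrajectory T u x γ →
        ConcaveOn ℝ (Icc 0 T) γ)) := by
  have h0 := left_mem_Icc.2 hT.le
  have hTc := right_mem_Icc.2 hT.le
  constructor
  · intro h hm₀
    have hs := h.toIsPositiveClassicalSolution
    have hinit : IsEvenDecreasing R fun x => m x 0 := by rwa [funext h.initial]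
    have hodd : ∀ t ∈ Icc 0 T, ∀ y, position u m (-y) t = -position u m y t := fun t ht y =>
      h.position_odd hR hT hf hg hf_mono hg_mono hinit.even ht y
    have hmx : ∀ t ∈ Icc 0 T, ∀ x ∈ Icc 0 (R / 2), spaceDeriv m x t ≤ 0 := fun t ht x hx =>
      hs.spaceDeriv_m_nonpos hR hT hf hf_mono hodd hinit
        (.inr ⟨fun r => deriv g r⁻¹ * r⁻¹ ^ 3, fun y => by
          have hm := hs.pos (position u m y T) T hTc
          simp only [inv_inv]
          exact mul_nonneg (deriv_nonneg_of_monotoneOn_Ioi hg_mono hm) (by positivity),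
          h.velocity_terminal_eq hT hg⟩) ht hx
    have hanti := fun y hy => hs.antitoneOn_velocity (y := y) hR hT hf hf_mono hodd hmx hy
    have hux : ∀ x ∈ Icc 0 (R / 2), ∀ t ∈ Icc 0 T, spaceDeriv u x t ≤ 0 := by
      intro x hx t ht
      -- Follow the particle located at `x` at time `t` up to time `T`: its velocity does not
      -- increase and ends at `-g'(m) m_x ≥ 0`.
      have hy := hs.massCoord_mem hR hT ht (hodd t ht) hx
      have h1 := hanti _ hy ht hTc ht.2
      have hxT := (hs.position_mem_iff hR hT hTc (hodd T hTc) _).2 hy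
      have h2 := mul_nonpos_of_nonneg_of_nonpos
        (deriv_nonneg_of_monotoneOn_Ioi hg_mono
          (hs.pos (position u m (massCoord u m x t) T) T hTc)) (hmx T hTc _ hxT)
      rw [← h.velocity_terminal hT hg] at h2
      simp only [hs.position_massCoord ht] at h1
      linarith
    refine ⟨fun t ht => hs.isEvenDecreasing hR hT ht (hodd t ht) (hmx t ht),
      fun x hx γ hγ => ⟨hs.concaveOn_trajectory hT hγ
        (hanti _ (hs.massCoord_mem hR hT h0 (hodd 0 h0) hx)), ?_⟩, hux⟩
    have hy := hs.massCoord_mem hR hT h0 (hodd 0 h0) hx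
    refine monotoneOn_of_hasDerivWithinAt_nonneg (convex_Icc _ _)
      (fun t ht => (hγ.flow t ht).continuousWithinAt)
      (fun t ht => (hγ.flow t (interior_subset ht)).mono interior_subset) fun t ht => ?_
    have htc := interior_subset ht
    have hmem : γ t ∈ Icc 0 (R / 2) := by
      rw [hs.eq_position_of_isOptimalTrajectory hT hγ htc]
      exact (hs.position_mem_iff hR hT htc (hodd t htc) _).2 hy
    exact neg_nonneg.2 (hux _ hmem t htc)
  · intro h hm₀ hmT
    have hs := h.toIsPositiveClassicalSolution
    have hinit : IsEvenDecreasing R fun x => m x 0 := by rwa [funext h.initial]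
    have hfinal : IsEvenDecreasing R fun x => m x T := by rwa [funext h.terminal]
    have hodd : ∀ t ∈ Icc 0 T, ∀ y, position u m (-y) t = -position u m y t := fun t ht y =>
      h.position_odd hR hT hf hf_mono hinit.even hfinal.even ht y
    have hmx : ∀ t ∈ Icc 0 T, ∀ x ∈ Icc 0 (R / 2), spaceDeriv m x t ≤ 0 := fun t ht x hx =>
      hs.spaceDeriv_m_nonpos hR hT hf hf_mono hodd hinit (.inl hfinal) ht hx
    exact ⟨fun t ht => hs.isEvenDecreasing hR hT ht (hodd t ht) (hmx t ht),
      fun x hx γ hγ => hs.concaveOn_trajectory hT hγ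
        (hs.antitoneOn_velocity hR hT hf hf_mono hodd hmx
          (hs.massCoord_mem hR hT h0 (hodd 0 h0) hx))⟩
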